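/- Let $A=(A_1,A_2,A_3)$, where each $A_j:\mathbb R^3\to\mathbb R$ is a real-valued measurable function with $A_j\in L^3(\mathbb R^3)$. Let $$\sigma_1=\begin{pmatrix}0&1\\1&0\end{pmatrix},\qquad \sigma_2=\begin{pmatrix}0&-i\\i&0\end{pmatrix},\qquad \sigma_3=\begin{pmatrix}1&0\\0&-1\end{pmatrix}$$ be the Pauli matrices and $D=\frac1i\nabla$. In the Hilbert space $\mathcal H=[L^2(\mathbb R^3)]^2$ let $T_0=\sigma\cdot D=\sum_{j=1}^3\sigma_j\,\frac1i\partial_j$ with domain the Sobolev space $[H^1(\mathbb R^3)]^2$ (derivatives in the sense of distributions), let $\sigma\cdot A$ be the operator of multiplication by the matrix function $\sum_{j=1}^3A_j(x)\sigma_j$ with its maximal domain $\{u\in\mathcal H : (\sigma\cdot A)u\in\mathcal H\}$, and let the Weyl–Dirac operator $T_A=\sigma\cdot(D-A)$ be the operator sum of $T_0$ and $-\sigma\cdot A$, defined on the intersection of their domains. Then $\mathrm{Dom}(T_A)=[H^1(\mathbb R^3)]^2$, the operator $T_A$ is self-adjoint, and its spectrum is $$\sigma(T_A)=\mathbb R .$$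 (The spectrum is the set of those $z\in\mathbb C$ for which $T_A-z:\mathrm{Dom}(T_A)\to\mathcal H$ has no everywhere defined bounded inverse.) -/

import Mathlib

noncomputable section

open MeasureTheory
open scoped SchwartzMap LineDeriv

namespace WeylDirac

/-- The configuration space `ℝ³`. -/
abbrev Space : Type := EuclideanSpace ℝ (Fin 3)

/-- The space `ℂ²` of spinors. -/
abbrev Spinor : Type := EuclideanSpace ℂ (Fin 2)

/-- The Hilbert space `[L²(ℝ³)]² = L²(ℝ³; ℂ²)`. -/
abbrev L2Spinor : Type := Lp Spinor 2 (volume : Measure Space)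

/-- The Pauli matrices `σ₁, σ₂, σ₃`. -/
def pauli : Fin 3 → Matrix (Fin 2) (Fin 2) ℂ :=
  ![!![0, 1; 1, 0], !![0, -Complex.I; Complex.I, 0], !![1, 0; 0, -1]]

/-- The Sobolev space `[H¹(ℝ³)]²`, as a subspace of `[L²(ℝ³)]²`. -/
def H1 : Submodule ℂ L2Spinor where
  carrier := {u | TemperedDistribution.MemSobolev 1 2 (u : 𝓢'(Space, Spinor))}
  zero_mem' := by
    have h := TemperedDistribution.memSobolev_fun_zero Space Spinor 1 2
    rwa [← map_zero (Lp.toTemperedDistributionCLM Spinor (volume : Measure Space) 2),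
      Lp.toTemperedDistributionCLM_apply] at h
  add_mem' := by
    intro u v hu hv
    have h := TemperedDistribution.MemSobolev.add hu hv
    rwa [← Lp.toTemperedDistributionCLM_apply, ← Lp.toTemperedDistributionCLM_apply, ← map_add,
      Lp.toTemperedDistributionCLM_apply] at h
  smul_mem' := by
    intro c u hu
    have h := TemperedDistribution.MemSobolev.smul c hu
    rwa [← Lp.toTemperedDistributionCLM_apply, ← map_smul,
      Lp.toTemperedDistributionCLM_apply] at h

/-- The `j`-th coordinate vector of `ℝ³`. -/
abbrev coord (j : Fin 3) : Space := EuclideanSpace.single j (1 : ℝ)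

theorem exists_partial (j : Fin 3) (u : H1) :
    ∃ v : L2Spinor,
      (v : 𝓢'(Space, Spinor)) = ∂_{coord j} ((u : L2Spinor) : 𝓢'(Space, Spinor)) := by
  have h := TemperedDistribution.MemSobolev.lineDerivOp (m := coord j) u.2
  rw [sub_self, TemperedDistribution.memSobolev_zero_iff] at h
  obtain ⟨v, hv⟩ := h
  exact ⟨v, hv.symm⟩

theorem toTemperedDistribution_injective {u v : L2Spinor}
    (h : (u : 𝓢'(Space, Spinor)) = (v : 𝓢'(Space, Spinor))) : u = v := by
  have hk := Lp.ker_toTemperedDistributionCLM_eq_bot (F := Spinor)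
    (μ := (volume : Measure Space)) (p := 2)
  exact LinearMap.ker_eq_bot.mp hk h

theorem toTemperedDistribution_add (u v : L2Spinor) :
    ((u + v : L2Spinor) : 𝓢'(Space, Spinor)) = (u : 𝓢'(Space, Spinor)) + v :=
  map_add (Lp.toTemperedDistributionCLM Spinor (volume : Measure Space) 2) u v

theorem toTemperedDistribution_smul (c : ℂ) (u : L2Spinor) :
    ((c • u : L2Spinor) : 𝓢'(Space, Spinor)) = c • (u : 𝓢'(Space, Spinor)) :=
  map_smul (Lp.toTemperedDistributionCLM Spinor (volume : Measure Space) 2) c u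

/-- The weak partial derivative `∂_j : [H¹(ℝ³)]² → [L²(ℝ³)]²`: the element of `L²` that represents
the distributional derivative. -/
def weakPartial (j : Fin 3) : H1 →ₗ[ℂ] L2Spinor where
  toFun u := (exists_partial j u).choose
  map_add' u v := by
    apply toTemperedDistribution_injective
    rw [(exists_partial j (u + v)).choose_spec, toTemperedDistribution_add,
      (exists_partial j u).choose_spec, (exists_partial j v).choose_spec, Submodule.coe_add,
      toTemperedDistribution_add, LineDeriv.lineDerivOp_add]
  map_smul' c u := by
    apply toTemperedDistribution_injective
    rw [(exists_partial j (c • u)).choose_spec, RingHom.id_apply, toTemperedDistribution_smul,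
      (exists_partial j u).choose_spec, Submodule.coe_smul, toTemperedDistribution_smul,
      LineDeriv.lineDerivOp_smul]

/-- The defining property of the weak partial derivative. -/
theorem weakPartial_spec (j : Fin 3) (u : H1) :
    (weakPartial j u : 𝓢'(Space, Spinor)) =
      ∂_{coord j} ((u : L2Spinor) : 𝓢'(Space, Spinor)) :=
  (exists_partial j u).choose_spec

/-- A `2 × 2` matrix acting pointwise on `[L²(ℝ³)]²`. -/
def matrixAct (M : Matrix (Fin 2) (Fin 2) ℂ) : L2Spinor →L[ℂ] L2Spinor :=
  (Matrix.toEuclideanCLM (𝕜 := ℂ) M).compLpL 2 volume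

/-- The free Weyl-Dirac operator `T₀ = σ · D`, `D = (1/i)∇`, with domain `[H¹(ℝ³)]²`. -/
def freeOp : L2Spinor →ₗ.[ℂ] L2Spinor where
  domain := H1
  toFun := ∑ j : Fin 3,
    (matrixAct (pauli j) : L2Spinor →ₗ[ℂ] L2Spinor) ∘ₗ ((1 / Complex.I : ℂ) • weakPartial j)

/-- The matrix-valued function `σ · A(x) = ∑ⱼ Aⱼ(x) σⱼ`. -/
def sigmaDot (A : Fin 3 → Space → ℝ) (x : Space) : Matrix (Fin 2) (Fin 2) ℂ :=
  ∑ j : Fin 3, (A j x : ℂ) • pauli j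

/-- The function `x ↦ (σ · A(x)) u(x)`. -/
def potentialFun (A : Fin 3 → Space → ℝ) (u : L2Spinor) (x : Space) : Spinor :=
  Matrix.toEuclideanCLM (𝕜 := ℂ) (sigmaDot A x) (u x)

theorem potentialFun_add (A : Fin 3 → Space → ℝ) (u v : L2Spinor) :
    potentialFun A (u + v) =ᵐ[volume] potentialFun A u + potentialFun A v := by
  filter_upwards [Lp.coeFn_add u v] with x hx
  simp only [potentialFun, hx, Pi.add_apply, map_add]

theorem potentialFun_smul (A : Fin 3 → Space → ℝ) (c : ℂ) (u : L2Spinor) :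
    potentialFun A (c • u) =ᵐ[volume] c • potentialFun A u := by
  filter_upwards [Lp.coeFn_smul c u] with x hx
  simp only [potentialFun, hx, Pi.smul_apply, map_smul]

theorem potentialFun_zero (A : Fin 3 → Space → ℝ) :
    potentialFun A 0 =ᵐ[volume] 0 := by
  filter_upwards [Lp.coeFn_zero Spinor 2 (volume : Measure Space)] with x hx
  simp only [potentialFun, hx, Pi.zero_apply, map_zero]

/-- The operator of multiplication by `σ · A(x)` in `[L²(ℝ³)]²` with its maximal domain
`{u ∈ [L²(ℝ³)]² | (σ · A) u ∈ [L²(ℝ³)]²}`. -/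
def potentialOp (A : Fin 3 → Space → ℝ) : L2Spinor →ₗ.[ℂ] L2Spinor where
  domain :=
    { carrier := {u | MemLp (potentialFun A u) 2 volume}
      zero_mem' := (memLp_congr_ae (potentialFun_zero A)).mpr MemLp.zero
      add_mem' := fun {u v} hu hv => (memLp_congr_ae (potentialFun_add A u v)).mpr (hu.add hv)
      smul_mem' := fun c u hu =>
        (memLp_congr_ae (potentialFun_smul A c u)).mpr (hu.const_smul c) }
  toFun :=
    { toFun := fun u => MemLp.toLp (potentialFun A u) u.2
      map_add' := fun u v => by
        rw [← MemLp.toLp_add]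
        exact MemLp.toLp_congr _ _ (potentialFun_add A u v)
      map_smul' := fun c u => by
        rw [RingHom.id_apply, ← MemLp.toLp_const_smul]
        exact MemLp.toLp_congr _ _ (potentialFun_smul A c u) }

/-- The Weyl-Dirac operator `T_A = σ · (D - A)`: the operator sum of `T₀ = σ · D` and `-σ · A`,
defined on the intersection of their domains. -/
def weylDirac (A : Fin 3 → Space → ℝ) : L2Spinor →ₗ.[ℂ] L2Spinor :=
  freeOp - potentialOp A

/-- The resolvent set of an operator `T` in a Hilbert (or normed) space: those `z` for which
`T - z : Dom T → H` has an everywhere defined bounded inverse. -/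
def resolventSet {H : Type*} [NormedAddCommGroup H] [NormedSpace ℂ H] (T : H →ₗ.[ℂ] H) : Set ℂ :=
  {z | ∃ R : H →L[ℂ] H,
    (∀ f : H, ∃ u : T.domain, (u : H) = R f ∧ T u - z • (u : H) = f) ∧
    (∀ u : T.domain, R (T u - z • (u : H)) = u)}

/-- The spectrum `σ(T)`: the complement of the resolvent set. -/
def spectrumOf {H : Type*} [NormedAddCommGroup H] [NormedSpace ℂ H] (T : H →ₗ.[ℂ] H) : Set ℂ :=
  (resolventSet T)ᶜ

end WeylDirac

end

/-! Self-adjointness is Kato–Rellich. The square of `T₀` is `-Δ`, so `(T₀ - z)(T₀ + z) = 4π² - Δ`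
for `z = ±2πi`. The right side is inverted by a Fourier multiplier, hence `T₀ - z` is onto, and a
symmetric densely defined operator with this property for conjugate `z` is self-adjoint
(`freeOp_isSelfAdjoint`). The Sobolev embedding of `H¹` in `L⁶` and Hölder with `1/3 + 1/6 = 1/2`
show that `σ·A` maps `H¹` to `L²`. Splitting `A` into a bounded part and a part small in `L³` gives
relative bound zero (`exists_norm_potentialOp_le`). The domain is therefore `H¹`, and
`isSelfAdjoint_sub_of_relBound` applies.

The spectrum of a self-adjoint operator is real. Conversely, for real `λ` take the plane wave
`exp(iλx₃) e₁` cut off at radius `R`. Its `L²` norm grows like `R^{3/2}`, while `(T₀ - λ)u` involves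
only the gradient of the cutoff and has norm `O(R^{1/2})`. Its `L⁶` norm is also `O(R^{1/2})`, and
so is the `L²` norm of `(σ·A)u`, by Hölder alone. Letting `R` grow rules out a lower bound for `T_A
- λ`, without any smallness or decay of `A` beyond `L³`. -/

noncomputable section

open MeasureTheory
open scoped SchwartzMap LineDeriv

namespace WeylDirac

/-! ### Unbounded operators: the basic self-adjointness criterion, Kato–Rellich, real spectrum. -/

section Operators

open ComplexConjugate LinearPMap

variable {H : Type*} [NormedAddCommGroup H] [InnerProductSpace ℂ H]

theorem symmetric_inner_self_im {T : H →ₗ.[ℂ] H} (hT : T.IsFormalAdjoint T) (u : T.domain) :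
    (inner ℂ (u : H) (T u)).im = 0 := by
  have h := hT u u
  rw [← inner_conj_symm] at h
  have := congrArg Complex.im h
  simp only [Complex.conj_im] at this
  linarith

/-- A symmetric operator satisfies `|Im z| ‖u‖ ≤ ‖(T - z) u‖`. -/
theorem abs_im_mul_norm_le {T : H →ₗ.[ℂ] H} (hT : T.IsFormalAdjoint T) (z : ℂ) (u : T.domain) :
    |z.im| * ‖(u : H)‖ ≤ ‖T u - z • (u : H)‖ := by
  by_cases hu : ‖(u : H)‖ = 0
  · rw [hu, mul_zero]; positivity
  have hu' : 0 < ‖(u : H)‖ := lt_of_le_of_ne (norm_nonneg _) (Ne.symm hu)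
  have h1 : (inner ℂ (u : H) (T u - z • (u : H))).im = - (z.im * ‖(u : H)‖ ^ 2) := by
    have h0 : inner ℂ (u : H) (u : H) = ((‖(u : H)‖ ^ 2 : ℝ) : ℂ) := by
      rw [inner_self_eq_norm_sq_to_K]; norm_cast
    rw [inner_sub_right, inner_smul_right, h0, Complex.sub_im, symmetric_inner_self_im hT,
      Complex.im_mul_ofReal, zero_sub]
  have h2 : |z.im| * ‖(u : H)‖ ^ 2 ≤ ‖(u : H)‖ * ‖T u - z • (u : H)‖ := by
    calc |z.im| * ‖(u : H)‖ ^ 2 = |(inner ℂ (u : H) (T u - z • (u : H))).im| := by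
          rw [h1, abs_neg, abs_mul, abs_of_nonneg (sq_nonneg ‖(u : H)‖)]
      _ ≤ ‖inner ℂ (u : H) (T u - z • (u : H))‖ := Complex.abs_im_le_norm _
      _ ≤ _ := norm_inner_le_norm _ _
  refine le_of_mul_le_mul_left ?_ hu'
  linarith

theorem eq_zero_of_apply_eq_smul {T : H →ₗ.[ℂ] H} (hT : T.IsFormalAdjoint T) {z : ℂ}
    (hz : z.im ≠ 0) {u : T.domain} (hu : T u = z • (u : H)) : (u : H) = 0 := by
  have h := abs_im_mul_norm_le hT z u
  rw [hu, sub_self, norm_zero] at h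
  have hz' := abs_pos.mpr hz
  exact norm_le_zero_iff.mp (nonpos_of_mul_nonpos_right h hz')

/-- For a symmetric operator, `‖(T - iη) u‖² = ‖T u‖² + η² ‖u‖²`. -/
theorem norm_sub_I_smul_sq {T : H →ₗ.[ℂ] H} (hT : T.IsFormalAdjoint T) (η : ℝ) (u : T.domain) :
    ‖T u - (η * Complex.I) • (u : H)‖ ^ 2 = ‖T u‖ ^ 2 + η ^ 2 * ‖(u : H)‖ ^ 2 := by
  have h : RCLike.re (inner ℂ (T u) ((η * Complex.I) • (u : H))) = 0 := by
    have h1 := symmetric_inner_self_im hT u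
    rw [inner_smul_right, hT u u]
    simp [h1]
  rw [norm_sub_sq (𝕜 := ℂ), h, norm_smul]
  simp [mul_pow]

variable [CompleteSpace H]

theorem isFormalAdjoint_of_isSelfAdjoint {T : H →ₗ.[ℂ] H} (hT : IsSelfAdjoint T) :
    T.IsFormalAdjoint T := by
  have h := adjoint_isFormalAdjoint hT.dense_domain
  rwa [isSelfAdjoint_def.mp hT] at h

/-- The basic criterion for self-adjointness: a densely defined symmetric operator `T` for which
`T - z` and `T - z̄` are surjective is self-adjoint. -/
theorem isSelfAdjoint_of_surjective {T : H →ₗ.[ℂ] H} (hd : Dense (T.domain : Set H))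
    (hT : T.IsFormalAdjoint T) (z : ℂ) (h₁ : ∀ f : H, ∃ u : T.domain, T u - z • (u : H) = f)
    (h₂ : ∀ f : H, ∃ u : T.domain, T u - conj z • (u : H) = f) : IsSelfAdjoint T := by
  rw [isSelfAdjoint_def]
  have hle : T ≤ T† := hT.le_adjoint hd
  -- It remains to put each `v` in the domain of `T†` into that of `T`. Solve `(T - z)u = (T† -
  -- z)v`; then `v - u` is orthogonal to the range of `T - z̄`, which is everything.
  refine (eq_of_le_of_domain_eq hle (le_antisymm hle.1 ?_)).symm
  intro v hv
  obtain ⟨u, hu⟩ := h₁ (T† ⟨v, hv⟩ - z • v)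
  suffices h : v - u = 0 by
    rw [sub_eq_zero.mp h]; exact u.2
  obtain ⟨x, hx⟩ := h₂ (v - u)
  have hvx : inner ℂ (T† ⟨v, hv⟩) (x : H) = inner ℂ v (T x) :=
    adjoint_isFormalAdjoint hd ⟨v, hv⟩ x
  have hux := hT u x
  have key : inner ℂ (v - u) (T x - conj z • (x : H)) = 0 := by
    have h3 : inner ℂ (T u - z • (u : H)) (x : H) = inner ℂ (T† ⟨v, hv⟩ - z • v) (x : H) := by
      rw [hu]
    simp only [inner_sub_left, inner_sub_right, inner_smul_left, inner_smul_right] at h3 ⊢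
    rw [hux, hvx] at h3
    linear_combination -h3
  rw [hx] at key
  exact inner_self_eq_zero.mp key

/-- If `T` is self-adjoint and `Im z ≠ 0`, then `T - z` is surjective. -/
theorem exists_sub_smul_eq {T : H →ₗ.[ℂ] H} (hT : IsSelfAdjoint T) {z : ℂ} (hz : z.im ≠ 0)
    (f : H) : ∃ u : T.domain, T u - z • (u : H) = f := by
  have hsym := isFormalAdjoint_of_isSelfAdjoint hT
  -- Regarded on the graph, `T - z` is a bounded map on a complete space (`T` is closed) and is
  -- bounded below, so its range is closed.
  let Φ : T.graph →L[ℂ] H :=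
    (ContinuousLinearMap.snd ℂ H H - z • ContinuousLinearMap.fst ℂ H H) ∘L T.graph.subtypeL
  have hΦ (u : T.domain) : Φ ⟨((u : H), T u), T.mem_graph u⟩ = T u - z • (u : H) := rfl
  have hz' := abs_pos.mpr hz
  have hcl : IsClosed (LinearMap.range Φ.toLinearMap : Set H) := by
    have : CompleteSpace T.graph := hT.isClosed.completeSpace_coe
    have hanti : AntilipschitzWith (Real.toNNReal (1 + (1 + ‖z‖) / |z.im|)) Φ := by
      refine Φ.antilipschitz_of_bound fun p => ?_
      obtain ⟨⟨a, b⟩, hp⟩ := p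
      obtain ⟨u, rfl, rfl⟩ := (T.mem_graph_iff).mp hp
      rw [hΦ, Real.coe_toNNReal _ (by positivity)]
      have h1 : ‖(u : H)‖ ≤ ‖T u - z • (u : H)‖ / |z.im| := by
        rw [le_div_iff₀ hz', mul_comm]; exact abs_im_mul_norm_le hsym z u
      have h2 : ‖T u‖ ≤ ‖T u - z • (u : H)‖ + ‖z‖ * ‖(u : H)‖ := by
        calc ‖T u‖ = ‖(T u - z • (u : H)) + z • (u : H)‖ := by rw [sub_add_cancel]
          _ ≤ _ := (norm_add_le _ _).trans (by rw [norm_smul])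
      have h3 : ‖z‖ * ‖(u : H)‖ ≤ ‖z‖ * (‖T u - z • (u : H)‖ / |z.im|) := by gcongr
      have h4 : (1 + (1 + ‖z‖) / |z.im|) * ‖T u - z • (u : H)‖
          = ‖T u - z • (u : H)‖ + ‖T u - z • (u : H)‖ / |z.im|
            + ‖z‖ * (‖T u - z • (u : H)‖ / |z.im|) := by ring
      rw [h4]
      refine max_le (h1.trans ?_) ?_
      · have : 0 ≤ ‖z‖ * (‖T u - z • (u : H)‖ / |z.im|) := by positivity
        have := norm_nonneg (T u - z • (u : H))
        linarith
      · have : 0 ≤ ‖T u - z • (u : H)‖ / |z.im| := by positivity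
        change ‖T u‖ ≤ _
        linarith
    exact hanti.isClosed_range Φ.uniformContinuous
  -- A vector orthogonal to the range is an eigenvector of `T† = T` for the non-real number `z̄`,
  -- hence zero.
  have horth : (LinearMap.range Φ.toLinearMap)ᗮ = ⊥ := by
    rw [Submodule.eq_bot_iff]
    intro v hv
    have hv' (x : T.domain) : inner ℂ (conj z • v) (x : H) = inner ℂ v (T x) := by
      have := (Submodule.mem_orthogonal' _ _).mp hv _ ⟨_, hΦ x⟩
      rw [inner_sub_right, inner_smul_right, sub_eq_zero] at this
      rw [inner_smul_left, this, Complex.conj_conj]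
    have hmem : v ∈ T†.domain := mem_adjoint_domain_of_exists v ⟨_, hv'⟩
    have happ := adjoint_apply_eq hT.dense_domain ⟨v, hmem⟩ hv'
    have hadj := isSelfAdjoint_def.mp hT
    have hsym' : (T†).IsFormalAdjoint (T†) := by rwa [hadj]
    exact eq_zero_of_apply_eq_smul hsym' (z := conj z) (by simpa using hz) happ
  have : CompleteSpace (LinearMap.range Φ.toLinearMap) := hcl.completeSpace_coe
  rw [Submodule.orthogonal_eq_bot_iff] at horth
  obtain ⟨⟨⟨a, b⟩, hp⟩, h⟩ : f ∈ LinearMap.range Φ.toLinearMap := horth ▸ Submodule.mem_top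
  obtain ⟨u, rfl, rfl⟩ := (T.mem_graph_iff).mp hp
  exact ⟨u, h⟩

/-- The non-real numbers belong to the resolvent set of a self-adjoint operator. -/
theorem mem_resolventSet_of_im_ne_zero {T : H →ₗ.[ℂ] H} (hT : IsSelfAdjoint T) {z : ℂ}
    (hz : z.im ≠ 0) : z ∈ resolventSet T := by
  have hsym := isFormalAdjoint_of_isSelfAdjoint hT
  have hz' := abs_pos.mpr hz
  choose g hg using exists_sub_smul_eq hT hz
  have hinj {u v : T.domain} (h : T u - z • (u : H) = T v - z • (v : H)) : u = v := by
    have h0 : ((u - v : T.domain) : H) = 0 := by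
      refine eq_zero_of_apply_eq_smul hsym hz ?_
      rw [T.map_sub, Submodule.coe_sub, smul_sub]
      rw [← sub_eq_zero] at h ⊢
      rw [← h]
      abel
    exact sub_eq_zero.mp (Subtype.ext h0)
  have hg' (u : T.domain) : g (T u - z • (u : H)) = u := hinj (hg _)
  let R : H →ₗ[ℂ] H :=
    { toFun := fun f => g f
      map_add' := fun a b => by
        rw [← Submodule.coe_add]
        congr 1
        apply hinj
        rw [hg, T.map_add, Submodule.coe_add, smul_add]
        nth_rewrite 1 [← hg a, ← hg b]
        abel
      map_smul' := fun c a => by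
        rw [RingHom.id_apply, ← Submodule.coe_smul]
        congr 1
        apply hinj
        rw [hg, T.map_smul, Submodule.coe_smul, smul_comm z c, ← smul_sub, hg] }
  refine ⟨R.mkContinuous |z.im|⁻¹ fun f => ?_, fun f => ⟨g f, rfl, hg f⟩, fun u => ?_⟩
  · have h := abs_im_mul_norm_le hsym z (g f)
    rw [hg] at h
    rw [inv_mul_eq_div, le_div_iff₀ hz', mul_comm]
    exact h
  · exact congrArg Subtype.val (hg' u)

/-- The **Kato–Rellich theorem** for the difference `T - V`. -/
theorem isSelfAdjoint_sub_of_relBound {T V : H →ₗ.[ℂ] H} (hT : IsSelfAdjoint T)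
    (hV : V.IsFormalAdjoint V) (hdom : T.domain ≤ V.domain) {a b : ℝ} (ha₀ : 0 ≤ a) (ha : a < 1)
    (hb : 0 ≤ b)
    (hbound : ∀ (u : H) (hu : u ∈ T.domain),
      ‖V ⟨u, hdom hu⟩‖ ≤ a * ‖T ⟨u, hu⟩‖ + b * ‖u‖) :
    IsSelfAdjoint (T - V) := by
  have hsym := isFormalAdjoint_of_isSelfAdjoint hT
  have hdom' : (T - V).domain = T.domain := by
    rw [LinearPMap.sub_domain]; exact inf_eq_left.mpr hdom
  have hsymTV : (T - V).IsFormalAdjoint (T - V) := by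
    intro x y
    rw [LinearPMap.sub_apply, LinearPMap.sub_apply, inner_sub_left, inner_sub_right]
    congr 1
    · exact hsym ⟨x, x.2.1⟩ ⟨y, y.2.1⟩
    · exact hV ⟨x, x.2.2⟩ ⟨y, y.2.2⟩
  have hsurj (η : ℝ) (hη : η ≠ 0) (hηb : a + b / |η| < 1) (f : H) :
      ∃ u : (T - V).domain, (T - V) u - (η * Complex.I) • (u : H) = f := by
    have him : (η * Complex.I : ℂ).im ≠ 0 := by simpa using hη
    obtain ⟨R, hR₁, hR₂⟩ := mem_resolventSet_of_im_ne_zero hT him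
    have hmem (f : H) : R f ∈ T.domain := by
      obtain ⟨u, hu, -⟩ := hR₁ f
      rw [← hu]; exact u.2
    have hRf (f : H) : T ⟨R f, hmem f⟩ - (η * Complex.I) • R f = f := by
      obtain ⟨u, hu, h⟩ := hR₁ f
      have : u = ⟨R f, hmem f⟩ := Subtype.ext hu
      subst this
      exact h
    -- With `R = (T - iη)⁻¹` and `K = VR` one has `(T - V - iη)R = 1 - K`. The identity `‖(T -
    -- iη)u‖² = ‖Tu‖² + η²‖u‖²` gives `‖K‖ ≤ a + b/|η|`, so `1 - K` is invertible once this is below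
    -- one.
    let K₀ : H →ₗ[ℂ] H := V.toFun ∘ₗ R.toLinearMap.codRestrict V.domain fun f => hdom (hmem f)
    let K : H →L[ℂ] H := K₀.mkContinuous (a + b / |η|) fun f => by
      have h1 := hbound (R f) (hmem f)
      have h2 := norm_sub_I_smul_sq hsym η ⟨R f, hmem f⟩
      rw [hRf] at h2
      change _ = ‖T ⟨R f, hmem f⟩‖ ^ 2 + η ^ 2 * ‖R f‖ ^ 2 at h2
      have h3 : ‖T ⟨R f, hmem f⟩‖ ≤ ‖f‖ :=
        le_of_sq_le_sq (by nlinarith [sq_nonneg (η * ‖R f‖)]) (norm_nonneg f)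
      have h4 : |η| * ‖R f‖ ≤ ‖f‖ :=
        le_of_sq_le_sq (by rw [mul_pow, sq_abs]; nlinarith [sq_nonneg ‖T ⟨R f, hmem f⟩‖])
          (norm_nonneg f)
      have h5 : ‖R f‖ ≤ ‖f‖ / |η| := by
        rw [le_div_iff₀ (abs_pos.mpr hη), mul_comm]; exact h4
      calc ‖V ⟨R f, hdom (hmem f)⟩‖ ≤ a * ‖T ⟨R f, hmem f⟩‖ + b * ‖R f‖ := h1
        _ ≤ a * ‖f‖ + b * (‖f‖ / |η|) := by gcongr
        _ = _ := by ring
    have hK : ‖K‖ < 1 := lt_of_le_of_lt (LinearMap.mkContinuous_norm_le _ (by positivity) _) hηb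
    obtain ⟨e, he⟩ := isUnit_one_sub_of_norm_lt_one hK
    obtain ⟨g, hg⟩ : ∃ g, g - K g = f := by
      refine ⟨(↑e⁻¹ : H →L[ℂ] H) f, ?_⟩
      have := congrArg (fun S : H →L[ℂ] H => S f) e.mul_inv
      rw [he] at this
      simpa using this
    refine ⟨⟨R g, hmem g, hdom (hmem g)⟩, ?_⟩
    rw [LinearPMap.sub_apply]
    have h6 := hRf g
    change T ⟨R g, hmem g⟩ - V ⟨R g, hdom (hmem g)⟩ - (η * Complex.I) • R g = f
    have h7 : K g = V ⟨R g, hdom (hmem g)⟩ := rfl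
    rw [← h7, sub_right_comm, h6, hg]
  have hd : Dense ((T - V).domain : Set H) := by rw [hdom']; exact hT.dense_domain
  -- For `η = (b + 1)/(1 - a)` the second term is `(1 - a) · b/(b + 1)`, which is less than `1 - a`.
  have hη : a + b / |(b + 1) / (1 - a)| < 1 := by
    rw [abs_of_pos (by have := sub_pos.mpr ha; positivity)]
    have := sub_pos.mpr ha
    have h1 : b / ((b + 1) / (1 - a)) = (1 - a) * (b / (b + 1)) := by field_simp
    have h2 : b / (b + 1) < 1 := by rw [div_lt_one (by positivity)]; linarith
    rw [h1]
    nlinarith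
  have hη0 : (b + 1) / (1 - a) ≠ 0 := by have := sub_pos.mpr ha; positivity
  refine isSelfAdjoint_of_surjective hd hsymTV (((b + 1) / (1 - a) : ℝ) * Complex.I)
    (hsurj _ hη0 hη) ?_
  have hconj : conj ((((b + 1) / (1 - a) : ℝ) : ℂ) * Complex.I)
      = ((-((b + 1) / (1 - a)) : ℝ) : ℂ) * Complex.I := by
    rw [map_mul, Complex.conj_ofReal, Complex.conj_I]; push_cast; ring
  rw [hconj]
  exact hsurj _ (neg_ne_zero.mpr hη0) (by rwa [abs_neg])

/-- The spectrum of a self-adjoint operator is real. -/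
theorem spectrumOf_subset_real {T : H →ₗ.[ℂ] H} (hT : IsSelfAdjoint T) :
    spectrumOf T ⊆ Set.range ((↑) : ℝ → ℂ) := by
  intro z hz
  by_contra h
  refine hz (mem_resolventSet_of_im_ne_zero hT fun him => h ⟨z.re, ?_⟩)
  exact Complex.ext (by simp) (by simp [him])

omit [CompleteSpace H] in
/-- In the resolvent set, `T - z` is bounded below. -/
theorem exists_norm_le_of_mem_resolventSet {T : H →ₗ.[ℂ] H} {z : ℂ} (hz : z ∈ resolventSet T) :
    ∃ C : ℝ, ∀ u : T.domain, ‖(u : H)‖ ≤ C * ‖T u - z • (u : H)‖ := by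
  obtain ⟨R, -, hR⟩ := hz
  exact ⟨‖R‖, fun u => by
    conv_lhs => rw [← hR u]
    exact R.le_opNorm _⟩

end Operators

/-! ### Fourier multipliers, `H¹` as the range of the Bessel potential, and matrix actions. -/

section Sobolev

open TemperedDistribution FourierTransform Filter Topology

/-- The Fourier multiplier with a bounded symbol of temperate growth, as an operator on `L²`. -/
def multiplier (m : Space → ℂ) (hm : MemLp m ⊤ volume) : L2Spinor →L[ℂ] L2Spinor :=
  (fourierInvCLM ℂ L2Spinor) ∘L
    ((ContinuousLinearMap.lsmul ℂ ℂ : ℂ →L[ℂ] Spinor →L[ℂ] Spinor).holderL volume ⊤ 2 2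
      (hm.toLp m)) ∘L (fourierCLM ℂ L2Spinor)

/-- Boundedness of the symbol gives the operator on `L²`, temperate growth the one on distributions.
Their agreement lets multiplier identities be proved for distributions and pulled back by
injectivity. -/
theorem multiplier_toTemperedDistribution {m : Space → ℂ} (hm : MemLp m ⊤ volume)
    (hm' : m.HasTemperateGrowth) (f : L2Spinor) :
    ((multiplier m hm f : L2Spinor) : 𝓢'(Space, Spinor)) =
      fourierMultiplierCLM Spinor m (f : 𝓢'(Space, Spinor)) := by
  have h1 : multiplier m hm f = 𝓕⁻ (hm.toLp m • 𝓕 f : L2Spinor) := rfl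
  rw [h1, ← Lp.fourierInv_toTemperedDistribution_eq, Lp.toTemperedDistribution_smul_eq hm',
    ← Lp.fourier_toTemperedDistribution_eq, fourierMultiplierCLM_apply]

theorem multiplier_toLp {m : Space → ℂ} (hm : MemLp m ⊤ volume)
    (hm' : m.HasTemperateGrowth) (s : 𝓢(Space, Spinor)) :
    multiplier m hm (s.toLp 2) = (SchwartzMap.fourierMultiplierCLM Spinor m s).toLp 2 := by
  apply toTemperedDistribution_injective
  rw [multiplier_toTemperedDistribution hm hm', Lp.toTemperedDistribution_toLp_eq,
    Lp.toTemperedDistribution_toLp_eq, fourierMultiplierCLM_toTemperedDistributionCLM_eq hm']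

theorem memLp_top_of_bounded {m : Space → ℂ} (hm : m.HasTemperateGrowth) {C : ℝ}
    (hC : ∀ x, ‖m x‖ ≤ C) : MemLp m ⊤ volume :=
  memLp_top_of_bound hm.1.continuous.aestronglyMeasurable C (Eventually.of_forall hC)

/-- The symbol `(1 + |x|²)^{-1/2}`. -/
def besselSymbol (x : Space) : ℂ := ((1 + ‖x‖ ^ 2) ^ ((-1 : ℝ) / 2) : ℝ)

theorem besselSymbol_hasTemperateGrowth : besselSymbol.HasTemperateGrowth := by
  unfold besselSymbol; fun_prop

theorem norm_besselSymbol (x : Space) : ‖besselSymbol x‖ = (1 + ‖x‖ ^ 2) ^ ((-1 : ℝ) / 2) := by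
  rw [besselSymbol, Complex.norm_real, Real.norm_of_nonneg (by positivity)]

theorem norm_besselSymbol_le (x : Space) : ‖besselSymbol x‖ ≤ 1 := by
  rw [norm_besselSymbol]
  exact Real.rpow_le_one_of_one_le_of_nonpos (by simp) (by norm_num)

/-- The symbol `2πi x_j (1 + |x|²)^{-1/2}`. -/
def partialSymbol (j : Fin 3) (x : Space) : ℂ :=
  (2 * Real.pi * Complex.I) * ((inner ℝ x (coord j) : ℝ) * besselSymbol x)

theorem partialSymbol_hasTemperateGrowth (j : Fin 3) : (partialSymbol j).HasTemperateGrowth := by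
  have := besselSymbol_hasTemperateGrowth
  unfold partialSymbol; fun_prop

theorem norm_partialSymbol_le (j : Fin 3) (x : Space) : ‖partialSymbol j x‖ ≤ 2 * Real.pi := by
  have h1 : |inner ℝ x (coord j)| ≤ (1 + ‖x‖ ^ 2) ^ ((1 : ℝ) / 2) := by
    rw [← Real.sqrt_eq_rpow]
    apply Real.le_sqrt_of_sq_le
    have := abs_real_inner_le_norm x (coord j)
    rw [PiLp.norm_single, norm_one, mul_one] at this
    have := pow_le_pow_left₀ (abs_nonneg _) this 2
    linarith
  have h2 : ‖partialSymbol j x‖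
      = 2 * Real.pi * (|inner ℝ x (coord j)| * (1 + ‖x‖ ^ 2) ^ ((-1 : ℝ) / 2)) := by
    rw [partialSymbol, norm_mul, norm_mul _ (besselSymbol x), norm_besselSymbol]
    simp [Real.pi_pos.le, abs_of_nonneg]
  rw [h2]
  have h3 : (1 + ‖x‖ ^ 2) ^ ((1 : ℝ) / 2) * (1 + ‖x‖ ^ 2) ^ ((-1 : ℝ) / 2) = 1 := by
    rw [← Real.rpow_add (by positivity)]; norm_num
  have h4 : |inner ℝ x (coord j)| * (1 + ‖x‖ ^ 2) ^ ((-1 : ℝ) / 2) ≤ 1 := by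
    refine le_trans ?_ h3.le
    gcongr
  nlinarith [Real.pi_pos]

/-- The Bessel potential `(1 - Δ/4π²)^{-1/2}` on `L²`, which maps onto `H¹`. -/
def bessel : L2Spinor →L[ℂ] L2Spinor :=
  multiplier besselSymbol (memLp_top_of_bounded besselSymbol_hasTemperateGrowth norm_besselSymbol_le)

/-- The bounded operator `∂_j (1 - Δ/4π²)^{-1/2}`. -/
def besselPartial (j : Fin 3) : L2Spinor →L[ℂ] L2Spinor :=
  multiplier (partialSymbol j)
    (memLp_top_of_bounded (partialSymbol_hasTemperateGrowth j) (norm_partialSymbol_le j))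

theorem bessel_toTemperedDistribution (f : L2Spinor) :
    ((bessel f : L2Spinor) : 𝓢'(Space, Spinor)) =
      besselPotential Space Spinor (-1) (f : 𝓢'(Space, Spinor)) :=
  multiplier_toTemperedDistribution _ besselSymbol_hasTemperateGrowth f

theorem bessel_mem (f : L2Spinor) : bessel f ∈ H1 := by
  change MemSobolev 1 2 _
  rw [bessel_toTemperedDistribution, memSobolev_besselPotential_iff, neg_add_cancel,
    memSobolev_zero_iff]
  exact ⟨f, rfl⟩

theorem exists_bessel_eq (u : H1) : ∃ f, bessel f = u := by
  obtain ⟨f, hf⟩ := u.2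
  refine ⟨f, toTemperedDistribution_injective ?_⟩
  rw [bessel_toTemperedDistribution, (besselPotential_neg_apply_eq_iff 1 _ _).mpr hf]

theorem eq_weakPartial {j : Fin 3} {u : H1} {v : L2Spinor}
    (h : (v : 𝓢'(Space, Spinor)) = ∂_{coord j} ((u : L2Spinor) : 𝓢'(Space, Spinor))) :
    weakPartial j u = v :=
  toTemperedDistribution_injective ((weakPartial_spec j u).trans h.symm)

/-- In the parametrization `u = bessel f` of `H¹`, the unbounded `∂_j` becomes an `L²`-bounded
multiplier in `f`. -/
theorem weakPartial_bessel (j : Fin 3) (f : L2Spinor) :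
    weakPartial j ⟨bessel f, bessel_mem f⟩ = besselPartial j f := by
  apply eq_weakPartial
  have hi : (fun x : Space => ((inner ℝ x (coord j) : ℝ) : ℂ)).HasTemperateGrowth := by fun_prop
  have hb := besselSymbol_hasTemperateGrowth
  have hbf : ((bessel f : L2Spinor) : 𝓢'(Space, Spinor)) =
      fourierMultiplierCLM Spinor besselSymbol (f : 𝓢'(Space, Spinor)) :=
    multiplier_toTemperedDistribution _ hb f
  rw [besselPartial, multiplier_toTemperedDistribution _ (partialSymbol_hasTemperateGrowth j), hbf,
    lineDeriv_eq_fourierMultiplierCLM, fourierMultiplierCLM_fourierMultiplierCLM_apply hb hi]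
  have h1 : partialSymbol j = (2 * Real.pi * Complex.I : ℂ) •
      (besselSymbol * fun x : Space => ((inner ℝ x (coord j) : ℝ) : ℂ)) := by
    ext x
    simp only [partialSymbol, Pi.smul_apply, Pi.mul_apply, smul_eq_mul]
    ring
  rw [h1, fourierMultiplierCLM_smul (hb.mul hi)]
  rfl

/-- A Schwartz function as an element of `H¹`. -/
def schwartzH1 (s : 𝓢(Space, Spinor)) : H1 :=
  ⟨s.toLp 2, by
    change MemSobolev 1 2 _
    rw [Lp.toTemperedDistribution_toLp_eq]
    exact s.memSobolev⟩

theorem weakPartial_schwartzH1 (j : Fin 3) (s : 𝓢(Space, Spinor)) :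
    weakPartial j (schwartzH1 s) = (∂_{coord j} s).toLp 2 := by
  apply eq_weakPartial
  rw [schwartzH1, Lp.toTemperedDistribution_toLp_eq, Lp.toTemperedDistribution_toLp_eq,
    lineDerivOp_toTemperedDistributionCLM_eq]

/-- Schwartz functions are dense in `H¹`. -/
theorem exists_schwartz_tendsto (u : H1) : ∃ s : ℕ → 𝓢(Space, Spinor),
    Tendsto (fun n => (s n).toLp 2 volume) atTop (𝓝 (u : L2Spinor)) ∧
    ∀ j, Tendsto (fun n => (∂_{coord j} (s n)).toLp 2 volume) atTop (𝓝 (weakPartial j u)) := by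
  obtain ⟨f, hf⟩ := exists_bessel_eq u
  have hu : u = ⟨bessel f, bessel_mem f⟩ := Subtype.ext hf.symm
  have hd := SchwartzMap.denseRange_toLpCLM (F := Spinor) (E := Space) (p := 2)
    ENNReal.ofNat_ne_top (μ := volume)
  obtain ⟨g, hg, hgf⟩ := mem_closure_iff_seq_limit.mp (hd f)
  choose t ht using hg
  have hb (n : ℕ) : bessel (g n) =
      (SchwartzMap.fourierMultiplierCLM Spinor besselSymbol (t n)).toLp 2 := by
    rw [← ht]; exact multiplier_toLp _ besselSymbol_hasTemperateGrowth _
  -- The Schwartz approximants of `f` in `L²` stay Schwartz under the Bessel potential. Since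
  -- `bessel` and `besselPartial j` are bounded, both limits follow.
  refine ⟨fun n => SchwartzMap.fourierMultiplierCLM Spinor besselSymbol (t n), ?_, fun j => ?_⟩
  · simp only [← hb, hu]
    exact (bessel.continuous.tendsto f).comp hgf
  · have h (n : ℕ) : (∂_{coord j}
        (SchwartzMap.fourierMultiplierCLM Spinor besselSymbol (t n))).toLp 2 volume
        = besselPartial j (g n) := by
      rw [← weakPartial_bessel, ← weakPartial_schwartzH1]
      congr 1
      exact Subtype.ext (hb n).symm
    simp only [h, hu, weakPartial_bessel]
    exact ((besselPartial j).continuous.tendsto f).comp hgf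

theorem dense_H1 : Dense (H1 : Set L2Spinor) := by
  have hd := SchwartzMap.denseRange_toLpCLM (F := Spinor) (E := Space) (p := 2)
    ENNReal.ofNat_ne_top (μ := volume)
  refine hd.mono ?_
  rintro _ ⟨s, rfl⟩
  exact (schwartzH1 s).2

theorem inner_lineDeriv_schwartz (m : Space) (s t : 𝓢(Space, Spinor)) :
    inner ℂ ((∂_{m} s).toLp 2 volume) (t.toLp 2 volume)
      = -inner ℂ (s.toLp 2 volume) ((∂_{m} t).toLp 2 volume) := by
  rw [SchwartzMap.inner_toL2_toL2_eq _ _ volume, SchwartzMap.inner_toL2_toL2_eq _ _ volume]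
  -- The complex inner product is only sesquilinear, so it enters as a real bilinear map.
  have h := SchwartzMap.integral_bilinear_lineDerivOp_right_eq_neg_left (μ := volume) s t
    (isBoundedBilinearMap_inner (𝕜 := ℂ) (E := Spinor)).toContinuousLinearMap m
  rw [eq_neg_iff_add_eq_zero, ← eq_neg_iff_add_eq_zero.mp h, add_comm]
  rfl

/-- Integration by parts in `H¹`. -/
theorem inner_weakPartial (j : Fin 3) (u v : H1) :
    inner ℂ (weakPartial j u) (v : L2Spinor) = -inner ℂ (u : L2Spinor) (weakPartial j v) := by
  obtain ⟨s, hs, hs'⟩ := exists_schwartz_tendsto u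
  obtain ⟨t, ht, ht'⟩ := exists_schwartz_tendsto v
  refine tendsto_nhds_unique ((hs' j).inner ht) ?_
  simp only [inner_lineDeriv_schwartz]
  exact (hs.inner (ht' j)).neg

/-! ### Matrices acting on spinors -/

theorem matrixAct_toTemperedDistribution_apply (M : Matrix (Fin 2) (Fin 2) ℂ) (u : L2Spinor)
    (g : 𝓢(Space, ℂ)) :
    (matrixAct M u : 𝓢'(Space, Spinor)) g
      = Matrix.toEuclideanCLM (𝕜 := ℂ) M ((u : 𝓢'(Space, Spinor)) g) := by
  rw [Lp.toTemperedDistribution_apply, Lp.toTemperedDistribution_apply,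
    ← ContinuousLinearMap.integral_comp_comm]
  · refine integral_congr_ae ?_
    filter_upwards [ContinuousLinearMap.coeFn_compLpL (p := 2) (μ := volume)
      (Matrix.toEuclideanCLM (𝕜 := ℂ) M) u] with x hx
    rw [matrixAct, hx, map_smul]
  · exact memLp_one_iff_integrable.mp (MemLp.smul (p := 2) (q := 2) (Lp.memLp u) (g.memLp 2 volume))

/-- A constant matrix acts on the values and Fourier multipliers act on the test functions, so the
two commute. -/
theorem matrixAct_mem (M : Matrix (Fin 2) (Fin 2) ℂ) (u : H1) :
    matrixAct M (u : L2Spinor) ∈ H1 := by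
  obtain ⟨f, hf⟩ := u.2
  refine ⟨matrixAct M f, ?_⟩
  ext1 g
  rw [matrixAct_toTemperedDistribution_apply, ← hf]
  simp only [besselPotential, fourierMultiplierCLM_apply_apply]
  rw [matrixAct_toTemperedDistribution_apply]

theorem weakPartial_matrixAct (M : Matrix (Fin 2) (Fin 2) ℂ) (j : Fin 3) (u : H1) :
    weakPartial j ⟨matrixAct M (u : L2Spinor), matrixAct_mem M u⟩
      = matrixAct M (weakPartial j u) := by
  apply eq_weakPartial
  ext1 g
  rw [matrixAct_toTemperedDistribution_apply, weakPartial_spec, lineDerivOp_apply_apply,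
    lineDerivOp_apply_apply, matrixAct_toTemperedDistribution_apply]

theorem matrixAct_coeFn (M : Matrix (Fin 2) (Fin 2) ℂ) (u : L2Spinor) :
    matrixAct M u =ᵐ[volume] fun x => Matrix.toEuclideanCLM (𝕜 := ℂ) M (u x) :=
  ContinuousLinearMap.coeFn_compLpL _ _

theorem matrixAct_mul (M N : Matrix (Fin 2) (Fin 2) ℂ) (u : L2Spinor) :
    matrixAct M (matrixAct N u) = matrixAct (M * N) u := by
  apply Lp.ext
  filter_upwards [matrixAct_coeFn M (matrixAct N u), matrixAct_coeFn N u,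
    matrixAct_coeFn (M * N) u] with x h1 h2 h3
  rw [h1, h2, h3, map_mul]
  rfl

theorem matrixAct_add (M N : Matrix (Fin 2) (Fin 2) ℂ) (u : L2Spinor) :
    matrixAct (M + N) u = matrixAct M u + matrixAct N u := by
  apply Lp.ext
  filter_upwards [matrixAct_coeFn M u, matrixAct_coeFn N u,
    matrixAct_coeFn (M + N) u, Lp.coeFn_add (matrixAct M u) (matrixAct N u)] with x h1 h2 h3 h4
  rw [h3, h4, Pi.add_apply, h1, h2, map_add]
  rfl

theorem matrixAct_one (u : L2Spinor) : matrixAct 1 u = u := by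
  apply Lp.ext
  filter_upwards [matrixAct_coeFn 1 u] with x h1
  rw [h1, map_one]
  rfl

theorem matrixAct_zero (u : L2Spinor) : matrixAct 0 u = 0 := by
  have := matrixAct_add 0 0 u
  simpa using this

theorem inner_matrixAct {M : Matrix (Fin 2) (Fin 2) ℂ} (hM : M.IsHermitian) (u v : L2Spinor) :
    inner ℂ (matrixAct M u) v = inner ℂ u (matrixAct M v) := by
  rw [L2.inner_def, L2.inner_def]
  refine integral_congr_ae ?_
  filter_upwards [matrixAct_coeFn M u, matrixAct_coeFn M v] with x h1 h2
  rw [h1, h2, ← ContinuousLinearMap.adjoint_inner_right, ← ContinuousLinearMap.star_eq_adjoint,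
    ← map_star, Matrix.star_eq_conjTranspose, hM]

theorem pauli_isHermitian (j : Fin 3) : (pauli j).IsHermitian := by
  fin_cases j <;> ext a b <;> fin_cases a <;> fin_cases b <;> simp [pauli]

theorem pauli_mul_self (j : Fin 3) : pauli j * pauli j = 1 := by
  fin_cases j <;> ext a b <;> fin_cases a <;> fin_cases b <;> simp [pauli]

theorem pauli_anticommute {j k : Fin 3} (h : j ≠ k) : pauli j * pauli k + pauli k * pauli j = 0 := by
  fin_cases j <;> fin_cases k <;>
    first
    | exact absurd rfl h
    | (ext a b; fin_cases a <;> fin_cases b <;> simp [pauli])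

end Sobolev

/-! ### Self-adjointness of `T₀` and equivalence of its graph norm with the `H¹` norm. -/

section FreeOperator

open TemperedDistribution ComplexConjugate

/-- The free Weyl–Dirac operator as a linear map on `H¹`. -/
def freeMap : H1 →ₗ[ℂ] L2Spinor := freeOp.toFun

theorem freeMap_apply (u : H1) :
    freeMap u = ∑ j : Fin 3, matrixAct (pauli j) ((1 / Complex.I : ℂ) • weakPartial j u) := by
  simp [freeMap, freeOp]

theorem freeOp_isFormalAdjoint : freeOp.IsFormalAdjoint freeOp := by
  intro (u : H1) (v : H1)
  change inner ℂ (freeMap u) (v : L2Spinor) = inner ℂ (u : L2Spinor) (freeMap v)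
  rw [freeMap_apply, freeMap_apply, sum_inner, inner_sum]
  refine Finset.sum_congr rfl fun j _ => ?_
  -- Integration by parts is applied against `σ_j v`, which is again in `H¹`. Its minus sign cancels
  -- the one from conjugating `1/i`.
  have h := inner_weakPartial j u ⟨matrixAct (pauli j) (v : L2Spinor), matrixAct_mem _ v⟩
  rw [weakPartial_matrixAct] at h
  rw [inner_matrixAct (pauli_isHermitian j), inner_smul_left, h, map_smul, inner_smul_right]
  simp

theorem multiplier_comm {m n : Space → ℂ} (hm : MemLp m ⊤ volume) (hn : MemLp n ⊤ volume)
    (hm' : m.HasTemperateGrowth) (hn' : n.HasTemperateGrowth) (f : L2Spinor) :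
    multiplier m hm (multiplier n hn f) = multiplier n hn (multiplier m hm f) := by
  apply toTemperedDistribution_injective
  rw [multiplier_toTemperedDistribution hm hm', multiplier_toTemperedDistribution hn hn',
    multiplier_toTemperedDistribution hn hn', multiplier_toTemperedDistribution hm hm',
    fourierMultiplierCLM_fourierMultiplierCLM_apply hn' hm',
    fourierMultiplierCLM_fourierMultiplierCLM_apply hm' hn', mul_comm]

theorem besselPartial_bessel (j : Fin 3) (f : L2Spinor) :
    besselPartial j (bessel f) = bessel (besselPartial j f) :=
  multiplier_comm _ _ (partialSymbol_hasTemperateGrowth j) besselSymbol_hasTemperateGrowth f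

theorem besselPartial_comm (j k : Fin 3) (f : L2Spinor) :
    besselPartial j (besselPartial k f) = besselPartial k (besselPartial j f) :=
  multiplier_comm _ _ (partialSymbol_hasTemperateGrowth j) (partialSymbol_hasTemperateGrowth k) f

/-- With `b = besselSymbol`, this is `|x|² b² = 1 - b²` multiplied by `(2πi)² = -4π²`. -/
theorem sum_partialSymbol_sq :
    (fun x => ∑ j, (partialSymbol j * partialSymbol j) x)
      = (4 * Real.pi ^ 2 : ℂ) • (besselSymbol * besselSymbol) +
        fun _ => -(4 * Real.pi ^ 2 : ℂ) := by
  ext x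
  have h1 : besselSymbol x * besselSymbol x = ((1 + ‖x‖ ^ 2 : ℝ) : ℂ)⁻¹ := by
    rw [besselSymbol, ← Complex.ofReal_mul, ← Real.rpow_add (by positivity), ← Complex.ofReal_inv,
      ← Real.rpow_neg_one]
    norm_num
  have h2 : ((1 + ‖x‖ ^ 2 : ℝ) : ℂ) ≠ 0 := by
    rw [Complex.ofReal_ne_zero]; positivity
  have h3 : ((1 + ‖x‖ ^ 2 : ℝ) : ℂ) = 1 + (x 0 : ℂ) ^ 2 + (x 1 : ℂ) ^ 2 + (x 2 : ℂ) ^ 2 := by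
    rw [EuclideanSpace.real_norm_sq_eq, Fin.sum_univ_three]; push_cast; ring
  have h4 : besselSymbol x * besselSymbol x * ((1 + ‖x‖ ^ 2 : ℝ) : ℂ) = 1 := by
    rw [h1, inv_mul_cancel₀ h2]
  rw [h3] at h4
  simp only [partialSymbol, Pi.mul_apply, Pi.add_apply, Pi.smul_apply, smul_eq_mul,
    Fin.sum_univ_three, EuclideanSpace.inner_single_right, one_mul]
  simp only [conj_trivial]
  linear_combination (-(4 * Real.pi ^ 2 : ℂ)) * h4 +
    (4 * Real.pi ^ 2 * (besselSymbol x) ^ 2 * ((x 0 : ℂ) ^ 2 + (x 1 : ℂ) ^ 2 + (x 2 : ℂ) ^ 2) : ℂ)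
      * Complex.I_sq

theorem fourierMultiplierCLM_add {m n : Space → ℂ} (hm : m.HasTemperateGrowth)
    (hn : n.HasTemperateGrowth) :
    fourierMultiplierCLM Spinor (m + n)
      = fourierMultiplierCLM Spinor m + fourierMultiplierCLM Spinor n := by
  ext f u
  simp [SchwartzMap.smulLeftCLM_add hm hn, FourierTransform.fourier_add]

/-- `∑_j ∂_j² (1 - Δ/4π²)⁻¹ = 4π² ((1 - Δ/4π²)⁻¹ - 1)`. -/
theorem sum_besselPartial_sq (f : L2Spinor) :
    ∑ j, besselPartial j (besselPartial j f)
      = (4 * Real.pi ^ 2 : ℂ) • (bessel (bessel f) - f) := by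
  have hb := besselSymbol_hasTemperateGrowth
  have hp := partialSymbol_hasTemperateGrowth
  have h1 (j : Fin 3) : ((besselPartial j (besselPartial j f) : L2Spinor) : 𝓢'(Space, Spinor))
      = fourierMultiplierCLM Spinor (partialSymbol j * partialSymbol j) f := by
    rw [besselPartial, multiplier_toTemperedDistribution _ (hp j),
      multiplier_toTemperedDistribution _ (hp j),
      fourierMultiplierCLM_fourierMultiplierCLM_apply (hp j) (hp j)]
  have h2 : ((bessel (bessel f) : L2Spinor) : 𝓢'(Space, Spinor))
      = fourierMultiplierCLM Spinor (besselSymbol * besselSymbol) f := by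
    rw [bessel, multiplier_toTemperedDistribution _ hb, multiplier_toTemperedDistribution _ hb,
      fourierMultiplierCLM_fourierMultiplierCLM_apply hb hb]
  have h3 := fourierMultiplierCLM_sum Spinor (s := Finset.univ)
    (g := fun j => partialSymbol j * partialSymbol j) fun j _ => (hp j).mul (hp j)
  rw [sum_partialSymbol_sq, fourierMultiplierCLM_add (by
    have : (fun _ : Space => (4 * Real.pi ^ 2 : ℂ)).HasTemperateGrowth := by fun_prop
    exact this.mul (hb.mul hb)) (by fun_prop), fourierMultiplierCLM_smul (hb.mul hb),
    fourierMultiplierCLM_const] at h3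
  have h4 := congrArg (fun S => S (f : 𝓢'(Space, Spinor))) h3
  simp only [_root_.add_apply, _root_.sum_apply,
    _root_.smul_apply, ContinuousLinearMap.id_apply, ← h1, ← h2] at h4
  apply toTemperedDistribution_injective
  simp only [← Lp.toTemperedDistributionCLM_apply, map_sum, map_smul, map_sub] at h4 ⊢
  rw [← h4, smul_sub, neg_smul, sub_eq_add_neg]

/-- This is the algebra behind `T₀² = -Δ`: off-diagonal terms cancel in pairs because distinct Pauli
matrices anticommute and mixed derivatives are symmetric, and `σ_j² = 1` on the diagonal. -/
theorem sum_pauli_mul (Q : Fin 3 → Fin 3 → L2Spinor) (hQ : ∀ j k, Q j k = Q k j) :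
    ∑ k, ∑ j, matrixAct (pauli k * pauli j) (Q k j) = ∑ j, Q j j := by
  have h {j k : Fin 3} (hjk : j ≠ k) (v : L2Spinor) :
      matrixAct (pauli k * pauli j) v = -matrixAct (pauli j * pauli k) v := by
    rw [eq_neg_iff_add_eq_zero, ← matrixAct_add, pauli_anticommute hjk.symm, matrixAct_zero]
  simp only [Fin.sum_univ_three, pauli_mul_self, matrixAct_one]
  rw [h (show (0 : Fin 3) ≠ 1 by decide), h (show (0 : Fin 3) ≠ 2 by decide),
    h (show (1 : Fin 3) ≠ 2 by decide), hQ 1 0, hQ 2 0, hQ 2 1]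
  abel

theorem freeMap_bessel (f : L2Spinor) :
    freeMap ⟨bessel f, bessel_mem f⟩
      = ∑ j, matrixAct (pauli j) ((1 / Complex.I : ℂ) • besselPartial j f) := by
  rw [freeMap_apply]
  simp only [weakPartial_bessel]

/-- `T₀ - z` is surjective for `z = ±2πi`. -/
theorem exists_freeMap_sub_eq {z : ℂ} (hz : z ^ 2 = -(4 * Real.pi ^ 2)) (g : L2Spinor) :
    ∃ u : H1, freeMap u - z • (u : L2Spinor) = g := by
  have hpi : (4 * Real.pi ^ 2 : ℂ) ≠ 0 := by
    simp [Real.pi_ne_zero]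
  -- Here `w = (1 - Δ/4π²)⁻¹ g`, `v j = ∂_j w` and `y j = σ_j ∂_j w`. The two Bessel factors in `w`
  -- leave one for each `v j`, which keeps it in `H¹`.
  set w : H1 := ⟨bessel (bessel g), bessel_mem _⟩ with hw
  set v : Fin 3 → H1 := fun j => ⟨bessel (besselPartial j g), bessel_mem _⟩ with hv
  set y : Fin 3 → H1 := fun j => ⟨matrixAct (pauli j) (v j), matrixAct_mem _ _⟩ with hy
  have hTw : freeMap w = ∑ j, (1 / Complex.I : ℂ) • (y j : L2Spinor) := by
    rw [hw, freeMap_bessel]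
    simp only [besselPartial_bessel, map_smul]
    rfl
  have hTy (j : Fin 3) : freeMap (y j) = ∑ k, (1 / Complex.I : ℂ) •
      matrixAct (pauli k * pauli j) (besselPartial k (besselPartial j g)) := by
    rw [freeMap_apply]
    refine Finset.sum_congr rfl fun k _ => ?_
    rw [hy, weakPartial_matrixAct, hv, weakPartial_bessel, map_smul, matrixAct_mul]
  have key : ∑ j, (1 / Complex.I : ℂ) • freeMap (y j)
      = -((4 * Real.pi ^ 2 : ℂ) • ((w : L2Spinor) - g)) := by
    rw [← sum_besselPartial_sq, ← sum_pauli_mul _ fun j k => besselPartial_comm j k g,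
      Finset.sum_comm, ← Finset.sum_neg_distrib]
    refine Finset.sum_congr rfl fun j _ => ?_
    rw [hTy, Finset.smul_sum, ← Finset.sum_neg_distrib]
    refine Finset.sum_congr rfl fun k _ => ?_
    rw [smul_smul, ← neg_one_smul ℂ]
    congr 1
    field_simp
    simp
  -- `U = (T₀ + z)w`, so `(T₀ - z)U = (T₀² - z²)w = (4π² - Δ)w = 4π² g`.
  set U : H1 := ∑ j, (1 / Complex.I : ℂ) • y j + z • w with hU
  have hTU : freeMap U = -((4 * Real.pi ^ 2 : ℂ) • ((w : L2Spinor) - g))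
      + z • ∑ j, (1 / Complex.I : ℂ) • (y j : L2Spinor) := by
    rw [← key, ← hTw]
    simp only [hU, map_add, map_sum, map_smul]
  have hUc : (U : L2Spinor) = ∑ j, (1 / Complex.I : ℂ) • (y j : L2Spinor) + z • (w : L2Spinor) := by
    simp [hU]
  have hfin : freeMap U - z • (U : L2Spinor) = (4 * Real.pi ^ 2 : ℂ) • g := by
    rw [hTU, hUc, smul_add, smul_smul, ← pow_two, hz]
    module
  refine ⟨(4 * Real.pi ^ 2 : ℂ)⁻¹ • U, ?_⟩
  have : freeMap ((4 * Real.pi ^ 2 : ℂ)⁻¹ • U) = (4 * Real.pi ^ 2 : ℂ)⁻¹ • freeMap U :=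
    map_smul freeMap _ _
  rw [this, Submodule.coe_smul, smul_comm z, ← smul_sub, hfin, inv_smul_smul₀ hpi]

theorem two_pi_I_sq : (2 * Real.pi * Complex.I : ℂ) ^ 2 = -(4 * Real.pi ^ 2) := by
  rw [mul_pow, Complex.I_sq]; ring

/-- The free Weyl–Dirac operator is self-adjoint. -/
theorem freeOp_isSelfAdjoint : IsSelfAdjoint freeOp := by
  refine isSelfAdjoint_of_surjective dense_H1 freeOp_isFormalAdjoint (2 * Real.pi * Complex.I)
    (exists_freeMap_sub_eq two_pi_I_sq) (exists_freeMap_sub_eq ?_)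
  rw [← map_pow, two_pi_I_sq]
  simp [map_ofNat]

/-- The graph norm of `T₀` at `(1 - Δ/4π²)^{-1/2} f` controls the `L²` norm of `f`. -/
theorem exists_norm_le_freeMap_bessel : ∃ C : ℝ, 0 ≤ C ∧ ∀ f : L2Spinor,
    ‖f‖ ≤ C * (‖freeMap ⟨bessel f, bessel_mem f⟩‖ + ‖bessel f‖) := by
  let z : ℂ := 2 * Real.pi * Complex.I
  let D : L2Spinor →L[ℂ] L2Spinor :=
    ∑ j, matrixAct (pauli j) ∘L ((1 / Complex.I : ℂ) • besselPartial j) - z • bessel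
  have hD (f : L2Spinor) : D f = freeMap ⟨bessel f, bessel_mem f⟩ - z • bessel f := by
    rw [freeMap_bessel]
    simp [D]
  have hz : z.im ≠ 0 := by simp [z, Real.pi_ne_zero]
  -- `D = (T₀ - 2πi) ∘ bessel` is a bounded bijection of `L²`, so its inverse is bounded by the open
  -- mapping theorem.
  have hker : D.ker = ⊥ := by
    rw [LinearMap.ker_eq_bot']
    intro f (hf : D f = 0)
    rw [hD, sub_eq_zero] at hf
    have h0 : bessel f = 0 := eq_zero_of_apply_eq_smul freeOp_isFormalAdjoint hz hf
    apply toTemperedDistribution_injective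
    have h1 := bessel_toTemperedDistribution f
    rw [h0, eq_comm, besselPotential_neg_apply_eq_iff] at h1
    rw [← h1, ← Lp.toTemperedDistributionCLM_apply, map_zero, map_zero]
  have hran : D.range = ⊤ := by
    rw [LinearMap.range_eq_top]
    intro g
    obtain ⟨u, hu⟩ := exists_freeMap_sub_eq (z := z) two_pi_I_sq g
    obtain ⟨f, hf⟩ := exists_bessel_eq u
    refine ⟨f, ?_⟩
    have : u = ⟨bessel f, bessel_mem f⟩ := Subtype.ext hf.symm
    rw [← hu, this]
    exact hD f
  let e := ContinuousLinearEquiv.ofBijective D hker hran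
  refine ⟨‖(e.symm : L2Spinor →L[ℂ] L2Spinor)‖ * (1 + ‖z‖), by positivity, fun f => ?_⟩
  have h1 : ‖f‖ ≤ ‖(e.symm : L2Spinor →L[ℂ] L2Spinor)‖ * ‖D f‖ := by
    have := (e.symm : L2Spinor →L[ℂ] L2Spinor).le_opNorm (e f)
    simpa [e] using this
  have h2 : ‖D f‖ ≤ (1 + ‖z‖) * (‖freeMap ⟨bessel f, bessel_mem f⟩‖ + ‖bessel f‖) := by
    rw [hD]
    refine (norm_sub_le _ _).trans ?_
    rw [norm_smul]
    nlinarith [norm_nonneg z, norm_nonneg (bessel f),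
      norm_nonneg (freeMap ⟨bessel f, bessel_mem f⟩),
      mul_nonneg (norm_nonneg z) (norm_nonneg (freeMap ⟨bessel f, bessel_mem f⟩))]
  calc ‖f‖ ≤ _ := h1
    _ ≤ ‖(e.symm : L2Spinor →L[ℂ] L2Spinor)‖ *
        ((1 + ‖z‖) * (‖freeMap ⟨bessel f, bessel_mem f⟩‖ + ‖bessel f‖)) := by gcongr
    _ = _ := by ring

end FreeOperator

/-! ### The embedding of `H¹` in `L⁶`. -/

section SobolevInequality

open Filter Topology
open scoped ContDiff ENNReal NNReal

/-- A smooth cutoff function: `1` on the unit ball and supported in the ball of radius `2`. -/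
def cutoffBump : ContDiffBump (0 : Space) := ⟨1, 2, one_pos, one_lt_two⟩

/-- The smooth cutoff function at scale `R`. -/
def cutoff (R : ℝ) (x : Space) : ℝ := cutoffBump (R⁻¹ • x)

theorem contDiff_cutoff (R : ℝ) : ContDiff ℝ ∞ (cutoff R) :=
  cutoffBump.contDiff.comp (contDiff_id.const_smul R⁻¹)

theorem abs_cutoff_le (R : ℝ) (x : Space) : |cutoff R x| ≤ 1 := by
  rw [cutoff, abs_of_nonneg cutoffBump.nonneg]
  exact cutoffBump.le_one

theorem cutoff_eq_one {R : ℝ} (hR : 0 < R) {x : Space} (hx : ‖x‖ ≤ R) : cutoff R x = 1 := by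
  apply cutoffBump.one_of_mem_closedBall
  rw [mem_closedBall_zero_iff, norm_smul, norm_inv, Real.norm_of_nonneg hR.le]
  exact inv_mul_le_one_of_le₀ hx hR.le

theorem tsupport_cutoff_subset {R : ℝ} (hR : 0 < R) :
    tsupport (cutoff R) ⊆ Metric.closedBall 0 (2 * R) := by
  refine closure_minimal (fun x hx => ?_) Metric.isClosed_closedBall
  have h : R⁻¹ • x ∈ Function.support cutoffBump := hx
  rw [cutoffBump.support_eq, mem_ball_zero_iff, norm_smul, norm_inv,
    Real.norm_of_nonneg hR.le, inv_mul_lt_iff₀ hR] at h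
  rw [mem_closedBall_zero_iff, mul_comm]
  exact h.le

theorem hasCompactSupport_cutoff {R : ℝ} (hR : 0 < R) : HasCompactSupport (cutoff R) :=
  HasCompactSupport.of_support_subset_isCompact (isCompact_closedBall 0 (2 * R))
    ((subset_tsupport _).trans (tsupport_cutoff_subset hR))

/-- The chain rule for `x ↦ R⁻¹x` produces the factor `1/R`; this gain drives the approximate
eigenfunctions. -/
theorem exists_norm_fderiv_cutoff_le : ∃ K : ℝ, 0 ≤ K ∧ ∀ R : ℝ, 0 < R → ∀ x : Space,
    ‖fderiv ℝ (cutoff R) x‖ ≤ K / R := by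
  have hc : ContDiff ℝ 1 cutoffBump := cutoffBump.contDiff
  obtain ⟨K, hK⟩ := (cutoffBump.hasCompactSupport.fderiv (𝕜 := ℝ)).exists_bound_of_continuous
    (hc.continuous_fderiv one_ne_zero)
  refine ⟨K, (norm_nonneg _).trans (hK 0), fun R hR x => ?_⟩
  have hd : HasFDerivAt (cutoff R)
      ((fderiv ℝ cutoffBump (R⁻¹ • x)).comp (R⁻¹ • ContinuousLinearMap.id ℝ Space)) x :=
    ((hc.differentiable one_ne_zero _).hasFDerivAt).comp x ((hasFDerivAt_id x).const_smul R⁻¹)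
  rw [hd.fderiv, ContinuousLinearMap.comp_smul, ContinuousLinearMap.comp_id, norm_smul, norm_inv,
    Real.norm_of_nonneg hR.le, inv_mul_eq_div]
  have := hK (R⁻¹ • x)
  gcongr

theorem norm_le_sum_norm_coord (L : Space →L[ℝ] Spinor) : ‖L‖ ≤ ∑ j, ‖L (coord j)‖ := by
  refine L.opNorm_le_bound (by positivity) fun x => ?_
  have hx : x = ∑ j, x j • coord j := by
    ext i
    simp [Pi.single_apply]
  calc ‖L x‖ = ‖∑ j, x j • L (coord j)‖ := by
        conv_lhs => rw [hx]
        simp only [map_sum, map_smul]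
    _ ≤ ∑ j, ‖L (coord j)‖ * ‖x‖ := by
        refine norm_sum_le_of_le _ fun j _ => ?_
        rw [norm_smul, mul_comm]
        gcongr
        exact PiLp.norm_apply_le x j
    _ = _ := by rw [Finset.sum_mul]

/-- The Sobolev inequality for Schwartz functions. -/
theorem exists_eLpNorm_six_schwartz_le : ∃ C : ℝ≥0, ∀ s : 𝓢(Space, Spinor),
    eLpNorm s 6 volume ≤
      C * (∑ j, eLpNorm (∂_{coord j} s : 𝓢(Space, Spinor)) 2 volume + eLpNorm s 2 volume) := by
  obtain ⟨K, hK₀, hK⟩ := exists_norm_fderiv_cutoff_le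
  let C₀ : ℝ≥0 := SNormLESNormFDerivOfEqConst Spinor (volume : Measure Space) (2 : ℝ≥0)
  refine ⟨C₀ * (1 + K.toNNReal), fun s => ?_⟩
  have hs : ContDiff ℝ ∞ s := s.smooth _
  -- Gagliardo–Nirenberg–Sobolev needs compact support, so it is applied to cutoffs of `s` at scale
  -- `n + 1 ≥ 1`, where the cutoff gradient is at most `K`. The bound is uniform in `n`, and Fatou
  -- removes the cutoff.
  have hbound (n : ℕ) : eLpNorm (fun x => cutoff (n + 1) x • s x) 6 volume ≤
      (C₀ * (1 + K.toNNReal) : ℝ≥0) *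
        (∑ j, eLpNorm (∂_{coord j} s : 𝓢(Space, Spinor)) 2 volume + eLpNorm s 2 volume) := by
    have hn : (0 : ℝ) < n + 1 := by positivity
    have hcd : ContDiff ℝ 1 fun x => cutoff (n + 1) x • s x :=
      ((contDiff_cutoff _).smul hs).of_le (by norm_cast)
    have hgns := eLpNorm_le_eLpNorm_fderiv_of_eq (volume : Measure Space) hcd
      ((hasCompactSupport_cutoff hn).smul_right) (p := 2) (p' := 6) one_le_two
      (by simp) (by rw [finrank_euclideanSpace_fin]; norm_num)
    refine hgns.trans ?_
    rw [ENNReal.coe_mul, mul_assoc]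
    refine mul_le_mul' le_rfl ?_
    have hpt (x : Space) : ‖fderiv ℝ (fun x => cutoff (n + 1) x • s x) x‖ ≤
        (∑ j, (fun x => ‖(∂_{coord j} s : 𝓢(Space, Spinor)) x‖) + K • fun x => ‖s x‖) x := by
      have h1 : DifferentiableAt ℝ (cutoff (n + 1)) x :=
        (contDiff_cutoff _).differentiable (by simp) x
      rw [fderiv_fun_smul h1 s.differentiableAt]
      simp only [Pi.add_apply, Finset.sum_apply, Pi.smul_apply, smul_eq_mul]
      refine (norm_add_le _ _).trans (add_le_add ?_ ?_)
      · rw [norm_smul, Real.norm_eq_abs]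
        refine (mul_le_of_le_one_left (norm_nonneg _) (abs_cutoff_le _ x)).trans ?_
        refine (norm_le_sum_norm_coord _).trans (le_of_eq ?_)
        simp only [SchwartzMap.lineDerivOp_apply_eq_fderiv]
      · rw [ContinuousLinearMap.norm_smulRight_apply]
        gcongr
        refine (hK _ hn x).trans (div_le_self hK₀ ?_)
        have : (0 : ℝ) ≤ n := n.cast_nonneg
        linarith
    have hm (j : Fin 3) : AEStronglyMeasurable (fun x => ‖(∂_{coord j} s : 𝓢(Space, Spinor)) x‖) volume :=
      (∂_{coord j} s : 𝓢(Space, Spinor)).continuous.norm.aestronglyMeasurable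
    have hm' : AEStronglyMeasurable (K • fun x => ‖s x‖) volume :=
      (s.continuous.norm.aestronglyMeasurable).const_smul K
    refine (eLpNorm_mono_real hpt).trans ?_
    refine (eLpNorm_add_le (Finset.aestronglyMeasurable_sum _ fun j _ => hm j) hm'
      (by norm_num)).trans ?_
    rw [eLpNorm_const_smul, eLpNorm_norm]
    have h2 : eLpNorm (∑ j, fun x => ‖(∂_{coord j} s : 𝓢(Space, Spinor)) x‖) 2 volume
        ≤ ∑ j, eLpNorm (∂_{coord j} s : 𝓢(Space, Spinor)) 2 volume := by
      refine (eLpNorm_sum_le (fun j _ => hm j) (by norm_num)).trans (le_of_eq ?_)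
      simp only [eLpNorm_norm]
    have h3 : ‖K‖ₑ = (K.toNNReal : ℝ≥0∞) := Real.enorm_of_nonneg hK₀
    rw [h3, mul_add]
    push_cast
    refine add_le_add (h2.trans ?_) ?_
    · exact le_mul_of_one_le_left' le_self_add
    · exact mul_le_mul' le_add_self le_rfl
  have hlim : ∀ᵐ x ∂(volume : Measure Space),
      Tendsto (fun n : ℕ => cutoff (n + 1) x • s x) atTop (𝓝 (s x)) := by
    refine Eventually.of_forall fun x => tendsto_const_nhds.congr' ?_
    filter_upwards [eventually_ge_atTop ⌈‖x‖⌉₊] with n hn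
    have h1 : ‖x‖ ≤ n + 1 := (Nat.le_of_ceil_le hn).trans (by linarith)
    rw [cutoff_eq_one (by positivity) h1, one_smul]
  refine (Lp.eLpNorm_lim_le_liminf_eLpNorm (fun n => ?_) s hlim).trans ?_
  · exact ((contDiff_cutoff _).continuous.smul s.continuous).aestronglyMeasurable
  · exact liminf_le_of_le (by isBoundedDefault) fun b hb => by
      obtain ⟨n, hn⟩ := hb.exists
      exact hn.trans (hbound n)

/-- The Sobolev inequality in `H¹`. -/
theorem exists_eLpNorm_six_le : ∃ C : ℝ≥0, ∀ u : H1,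
    eLpNorm (u : L2Spinor) 6 volume ≤
      C * ENNReal.ofReal (∑ j, ‖weakPartial j u‖ + ‖(u : L2Spinor)‖) := by
  obtain ⟨C, hC⟩ := exists_eLpNorm_six_schwartz_le
  refine ⟨C, fun u => ?_⟩
  obtain ⟨s, hs, hs'⟩ := exists_schwartz_tendsto u
  -- Convergence in `L²` yields an almost everywhere convergent subsequence, along which Fatou
  -- applies to the `L⁶` norm.
  obtain ⟨ns, hns, hae⟩ := (tendstoInMeasure_of_tendsto_Lp hs).exists_seq_tendsto_ae
  have hnorm (t : 𝓢(Space, Spinor)) :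
      eLpNorm t 2 volume = ENNReal.ofReal ‖t.toLp 2 volume‖ := by
    rw [SchwartzMap.norm_toLp, ENNReal.ofReal_toReal (t.memLp 2 volume).eLpNorm_ne_top]
  have hb (n : ℕ) : eLpNorm ((s n).toLp 2 volume) 6 volume ≤
      C * ENNReal.ofReal (∑ j, ‖(∂_{coord j} (s n)).toLp 2 volume‖ + ‖(s n).toLp 2 volume‖) := by
    rw [eLpNorm_congr_ae ((s n).coeFn_toLp 2 volume),
      ENNReal.ofReal_add (by positivity) (by positivity),
      ENNReal.ofReal_sum_of_nonneg fun _ _ => norm_nonneg _]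
    simpa only [hnorm] using hC (s n)
  have hlim : Tendsto (fun n => (C : ℝ≥0∞) * ENNReal.ofReal
      (∑ j, ‖(∂_{coord j} (s n)).toLp 2 volume‖ + ‖(s n).toLp 2 volume‖)) atTop
      (𝓝 (C * ENNReal.ofReal (∑ j, ‖weakPartial j u‖ + ‖(u : L2Spinor)‖))) := by
    refine ENNReal.Tendsto.const_mul (ENNReal.tendsto_ofReal ?_) (Or.inr ENNReal.coe_ne_top)
    exact (tendsto_finsetSum _ fun j _ => (hs' j).norm).add hs.norm
  refine (Lp.eLpNorm_lim_le_liminf_eLpNorm (fun n => Lp.aestronglyMeasurable _) _ hae).trans ?_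
  rw [← (hlim.comp hns.tendsto_atTop).liminf_eq]
  exact liminf_le_liminf (Eventually.of_forall fun n => hb _)

/-- The Sobolev inequality in terms of the graph norm of `T₀`. -/
theorem exists_eLpNorm_six_le_freeMap : ∃ C : ℝ, 0 ≤ C ∧ ∀ u : H1,
    eLpNorm (u : L2Spinor) 6 volume ≤
      ENNReal.ofReal (C * (‖freeMap u‖ + ‖(u : L2Spinor)‖)) := by
  obtain ⟨C₁, hC₁⟩ := exists_eLpNorm_six_le
  obtain ⟨C₂, hC₂₀, hC₂⟩ := exists_norm_le_freeMap_bessel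
  refine ⟨C₁ * ((∑ j, ‖besselPartial j‖ + ‖bessel‖) * C₂), by positivity, fun u => ?_⟩
  obtain ⟨f, hf⟩ := exists_bessel_eq u
  obtain rfl : u = ⟨bessel f, bessel_mem f⟩ := Subtype.ext hf.symm
  refine (hC₁ _).trans ?_
  rw [← ENNReal.ofReal_coe_nnreal, ← ENNReal.ofReal_mul (by positivity)]
  refine ENNReal.ofReal_le_ofReal ?_
  rw [mul_assoc, mul_assoc]
  refine mul_le_mul_of_nonneg_left ?_ C₁.coe_nonneg
  simp only [weakPartial_bessel]
  calc ∑ j, ‖besselPartial j f‖ + ‖bessel f‖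
      ≤ ∑ j, ‖besselPartial j‖ * ‖f‖ + ‖bessel‖ * ‖f‖ :=
        add_le_add (Finset.sum_le_sum fun j _ => (besselPartial j).le_opNorm f) (bessel.le_opNorm f)
    _ = (∑ j, ‖besselPartial j‖ + ‖bessel‖) * ‖f‖ := by rw [add_mul, Finset.sum_mul]
    _ ≤ _ := mul_le_mul_of_nonneg_left (hC₂ f) (by positivity)

end SobolevInequality

/-! ### The potential as an infinitesimally small perturbation, and self-adjointness of `T_A`. -/

section Potential

open scoped ENNReal NNReal

/-- The Pauli matrices as operators on spinors. -/
def pauliCLM (j : Fin 3) : Spinor →L[ℂ] Spinor := Matrix.toEuclideanCLM (𝕜 := ℂ) (pauli j)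

theorem potentialFun_eq_sum (A : Fin 3 → Space → ℝ) (u : L2Spinor) (x : Space) :
    potentialFun A u x = ∑ j, (A j x : ℂ) • pauliCLM j (u x) := by
  simp only [potentialFun, sigmaDot, pauliCLM, map_sum, map_smul, _root_.sum_apply,
    _root_.smul_apply]

theorem aestronglyMeasurable_potentialFun {A : Fin 3 → Space → ℝ}
    (hA : ∀ j, AEStronglyMeasurable (A j) volume) (u : L2Spinor) :
    AEStronglyMeasurable (potentialFun A u) volume := by
  have h : potentialFun A u = fun x => ∑ j, (A j x : ℂ) • pauliCLM j (u x) :=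
    funext (potentialFun_eq_sum A u)
  rw [h]
  refine Finset.aestronglyMeasurable_fun_sum _ fun j _ => ?_
  exact (Complex.continuous_ofReal.comp_aestronglyMeasurable (hA j)).smul
    ((pauliCLM j).continuous.comp_aestronglyMeasurable (Lp.aestronglyMeasurable u))

/-- Hölder's inequality for the potential. -/
theorem eLpNorm_potentialFun_le {p q : ℝ≥0∞} [p.HolderTriple q 2] {A : Fin 3 → Space → ℝ}
    (hA : ∀ j, AEStronglyMeasurable (A j) volume) (u : L2Spinor) :
    eLpNorm (potentialFun A u) 2 volume ≤
      ∑ j, eLpNorm (A j) p volume * (‖pauliCLM j‖₊ * eLpNorm u q volume) := by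
  have h : potentialFun A u = ∑ j, (fun x => (A j x : ℂ)) • fun x => pauliCLM j (u x) := by
    ext1 x
    simp [potentialFun_eq_sum]
  have hAm (j : Fin 3) : AEStronglyMeasurable (fun x => (A j x : ℂ)) volume :=
    Complex.continuous_ofReal.comp_aestronglyMeasurable (hA j)
  have hum (j : Fin 3) : AEStronglyMeasurable (fun x => pauliCLM j (u x)) volume :=
    (pauliCLM j).continuous.comp_aestronglyMeasurable (Lp.aestronglyMeasurable u)
  rw [h]
  refine (eLpNorm_sum_le (fun j _ => (hAm j).smul (hum j)) (by norm_num)).trans ?_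
  refine Finset.sum_le_sum fun j _ => ?_
  refine (eLpNorm_smul_le_mul_eLpNorm (p := p) (q := q) (hum j) (hAm j)).trans ?_
  refine mul_le_mul' (le_of_eq ?_) ?_
  · exact eLpNorm_congr_norm_ae (Filter.Eventually.of_forall fun x => by simp)
  · exact eLpNorm_le_nnreal_smul_eLpNorm_of_ae_le_mul
      (Filter.Eventually.of_forall fun x => (pauliCLM j).le_opNNNorm _) q

instance holderTriple_three_six : ENNReal.HolderTriple 3 6 2 where
  inv_add_inv_eq_inv := by
    rw [← ENNReal.toReal_eq_toReal_iff' (by simp) (by simp),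
      ENNReal.toReal_add (by simp) (by simp)]
    norm_num

theorem sigmaDot_isHermitian (A : Fin 3 → Space → ℝ) (x : Space) :
    (sigmaDot A x).IsHermitian := by
  rw [Matrix.IsHermitian, sigmaDot, Matrix.conjTranspose_sum]
  refine Finset.sum_congr rfl fun j _ => ?_
  rw [Matrix.conjTranspose_smul, pauli_isHermitian j]
  simp

theorem inner_toEuclideanCLM {M : Matrix (Fin 2) (Fin 2) ℂ} (hM : M.IsHermitian) (a b : Spinor) :
    inner ℂ (Matrix.toEuclideanCLM (𝕜 := ℂ) M a) b
      = inner ℂ a (Matrix.toEuclideanCLM (𝕜 := ℂ) M b) := by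
  rw [← ContinuousLinearMap.adjoint_inner_right, ← ContinuousLinearMap.star_eq_adjoint,
    ← map_star, Matrix.star_eq_conjTranspose, hM]

theorem potentialOp_coeFn (A : Fin 3 → Space → ℝ) (u : (potentialOp A).domain) :
    potentialOp A u =ᵐ[volume] potentialFun A u :=
  MemLp.coeFn_toLp u.2

theorem norm_potentialOp (A : Fin 3 → Space → ℝ) (u : (potentialOp A).domain) :
    ‖potentialOp A u‖ = (eLpNorm (potentialFun A u) 2 volume).toReal := by
  rw [Lp.norm_def, eLpNorm_congr_ae (potentialOp_coeFn A u)]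

theorem potentialOp_isFormalAdjoint (A : Fin 3 → Space → ℝ) :
    (potentialOp A).IsFormalAdjoint (potentialOp A) := by
  intro u v
  rw [L2.inner_def, L2.inner_def]
  refine integral_congr_ae ?_
  filter_upwards [potentialOp_coeFn A u, potentialOp_coeFn A v] with x h1 h2
  rw [h1, h2, potentialFun, potentialFun, inner_toEuclideanCLM (sigmaDot_isHermitian A x)]

/-- `σ · A` is bounded from `L⁶` to `L²` when `A ∈ L³`. -/
theorem exists_eLpNorm_potentialFun_le {A : Fin 3 → Space → ℝ}
    (hA : ∀ j, MemLp (A j) 3 volume) : ∃ C : ℝ≥0, ∀ u : L2Spinor,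
    eLpNorm (potentialFun A u) 2 volume ≤ C * eLpNorm u 6 volume := by
  refine ⟨∑ j, (eLpNorm (A j) 3 volume).toNNReal * ‖pauliCLM j‖₊, fun u => ?_⟩
  refine (eLpNorm_potentialFun_le (p := 3) (q := 6) (fun j => (hA j).1) u).trans (le_of_eq ?_)
  push_cast
  rw [Finset.sum_mul]
  refine Finset.sum_congr rfl fun j _ => ?_
  rw [ENNReal.coe_toNNReal (hA j).eLpNorm_ne_top, mul_assoc]

theorem H1_le_potentialOp_domain {A : Fin 3 → Space → ℝ} (hA : ∀ j, MemLp (A j) 3 volume) :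
    H1 ≤ (potentialOp A).domain := by
  intro u hu
  obtain ⟨C, hC⟩ := exists_eLpNorm_potentialFun_le hA
  obtain ⟨C', -, hC'⟩ := exists_eLpNorm_six_le_freeMap
  refine ⟨aestronglyMeasurable_potentialFun (fun j => (hA j).1) u, (hC u).trans_lt ?_⟩
  exact ENNReal.mul_lt_top ENNReal.coe_lt_top ((hC' ⟨u, hu⟩).trans_lt ENNReal.ofReal_lt_top)

/-- `σ · A` is infinitesimally bounded with respect to `T₀`. -/
theorem exists_norm_potentialOp_le {A : Fin 3 → Space → ℝ} (hA : ∀ j, MemLp (A j) 3 volume)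
    {ε : ℝ} (hε : 0 < ε) : ∃ b : ℝ, 0 ≤ b ∧ ∀ u : H1,
    ‖potentialOp A ⟨u, H1_le_potentialOp_domain hA u.2⟩‖ ≤
      ε * ‖freeMap u‖ + b * ‖(u : L2Spinor)‖ := by
  obtain ⟨C, hC₀, hC⟩ := exists_eLpNorm_six_le_freeMap
  set P : ℝ := ∑ j, ‖pauliCLM j‖ with hP
  have hP₀ : 0 ≤ P := by positivity
  -- `δ` is the allowed `L³` error, chosen so that `δ P C ≤ ε`; the added ones keep the denominator
  -- positive.
  set δ : ℝ := ε / ((P + 1) * (C + 1)) with hδ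
  have hδ₀ : 0 < δ := by positivity
  have hδε : δ * P * C ≤ ε := by
    rw [hδ, div_mul_eq_mul_div, div_mul_eq_mul_div, div_le_iff₀ (by positivity), mul_assoc]
    gcongr <;> linarith
  -- Continuous compactly supported functions are dense in `L³`. The remainder `A - g` is treated by
  -- Hölder `(3, 6)` and Sobolev, and the bounded `g` by Hölder `(∞, 2)`.
  choose g hgc hgA hg hgm using fun j => (hA j).exists_hasCompactSupport_eLpNorm_sub_le
    (by simp) (ε := ENNReal.ofReal δ) (by simpa using hδ₀)
  choose M hM using fun j => (hgc j).exists_bound_of_continuous (hg j)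
  have hM₀ (j : Fin 3) : 0 ≤ M j := (norm_nonneg _).trans (hM j 0)
  have hS₀ : 0 ≤ ∑ j, M j * ‖pauliCLM j‖ :=
    Finset.sum_nonneg fun j _ => mul_nonneg (hM₀ j) (norm_nonneg _)
  -- The extra `ε` comes from the term `‖u‖` in the graph norm that bounds the `L⁶` norm.
  refine ⟨ε + ∑ j, M j * ‖pauliCLM j‖, by positivity, fun u => ?_⟩
  have hsplit : potentialFun A u = potentialFun (fun j => A j - g j) u + potentialFun g u := by
    ext1 x
    simp only [potentialFun_eq_sum, Pi.add_apply, Pi.sub_apply, ← Finset.sum_add_distrib,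
      ← add_smul]
    simp
  have hm1 (j : Fin 3) : AEStronglyMeasurable (A j - g j) volume := (hA j).1.sub (hgm j).1
  have hm2 (j : Fin 3) : AEStronglyMeasurable (g j) volume := (hgm j).1
  have h1 : eLpNorm (potentialFun (fun j => A j - g j) u) 2 volume ≤
      ENNReal.ofReal (ε * (‖freeMap u‖ + ‖(u : L2Spinor)‖)) := by
    refine (eLpNorm_potentialFun_le (p := 3) (q := 6) hm1 u).trans ?_
    calc ∑ j, eLpNorm (A j - g j) 3 volume * (‖pauliCLM j‖₊ * eLpNorm (u : L2Spinor) 6 volume)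
        ≤ ∑ j, ENNReal.ofReal δ * (ENNReal.ofReal ‖pauliCLM j‖ *
            ENNReal.ofReal (C * (‖freeMap u‖ + ‖(u : L2Spinor)‖))) := by
          refine Finset.sum_le_sum fun j _ => mul_le_mul' (hgA j) (mul_le_mul' ?_ (hC u))
          rw [← ENNReal.ofReal_coe_nnreal, coe_nnnorm]
      _ = ENNReal.ofReal (δ * P * C * (‖freeMap u‖ + ‖(u : L2Spinor)‖)) := by
          rw [← Finset.mul_sum, ← Finset.sum_mul,
            ← ENNReal.ofReal_sum_of_nonneg fun _ _ => norm_nonneg _, ← hP,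
            ← ENNReal.ofReal_mul hP₀, ← ENNReal.ofReal_mul hδ₀.le]
          congr 1
          ring
      _ ≤ _ := by gcongr
  have h2 : eLpNorm (potentialFun g u) 2 volume ≤
      ENNReal.ofReal ((∑ j, M j * ‖pauliCLM j‖) * ‖(u : L2Spinor)‖) := by
    refine (eLpNorm_potentialFun_le (p := ⊤) (q := 2) hm2 u).trans ?_
    rw [Finset.sum_mul, ENNReal.ofReal_sum_of_nonneg fun j _ =>
      mul_nonneg (mul_nonneg (hM₀ j) (norm_nonneg _)) (norm_nonneg _)]
    refine Finset.sum_le_sum fun j _ => ?_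
    rw [mul_assoc, ENNReal.ofReal_mul (hM₀ j), ENNReal.ofReal_mul (norm_nonneg _)]
    refine mul_le_mul' ?_ (mul_le_mul' ?_ ?_)
    · rw [eLpNorm_exponent_top]
      exact eLpNormEssSup_le_of_ae_bound (Filter.Eventually.of_forall (hM j))
    · rw [← ENNReal.ofReal_coe_nnreal, coe_nnnorm]
    · rw [Lp.norm_def, ENNReal.ofReal_toReal (Lp.eLpNorm_ne_top _)]
  rw [norm_potentialOp]
  refine ENNReal.toReal_le_of_le_ofReal (by positivity) ?_
  change eLpNorm (potentialFun A u) 2 volume ≤ _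
  rw [hsplit]
  refine (eLpNorm_add_le (aestronglyMeasurable_potentialFun hm1 _)
    (aestronglyMeasurable_potentialFun hm2 _) (by norm_num)).trans ?_
  refine (add_le_add h1 h2).trans ?_
  rw [← ENNReal.ofReal_add (by positivity) (by positivity)]
  refine ENNReal.ofReal_le_ofReal (le_of_eq ?_)
  ring

theorem weylDirac_domain {A : Fin 3 → Space → ℝ} (hA : ∀ j, MemLp (A j) 3 volume) :
    (weylDirac A).domain = H1 := by
  rw [weylDirac, LinearPMap.sub_domain]
  exact inf_eq_left.mpr (H1_le_potentialOp_domain hA)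

theorem weylDirac_isSelfAdjoint {A : Fin 3 → Space → ℝ} (hA : ∀ j, MemLp (A j) 3 volume) :
    IsSelfAdjoint (weylDirac A) := by
  obtain ⟨b, hb₀, hb⟩ := exists_norm_potentialOp_le hA one_half_pos
  exact isSelfAdjoint_sub_of_relBound freeOp_isSelfAdjoint (potentialOp_isFormalAdjoint A)
    (H1_le_potentialOp_domain hA) one_half_pos.le one_half_lt_one hb₀ fun u hu => hb ⟨u, hu⟩

end Potential

/-! ### Cut-off plane waves and the inclusion of the real line in the spectrum. -/

section Spectrum

open Filter Topology
open scoped ContDiff ENNReal NNReal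

theorem volume_closedBall_eq {R : ℝ} (hR : 0 < R) :
    volume (Metric.closedBall (0 : Space) R)
      = ENNReal.ofReal (R ^ 3 * (volume (Metric.ball (0 : Space) 1)).toReal) := by
  rw [Measure.addHaar_closedBall _ _ hR.le, finrank_euclideanSpace_fin,
    ENNReal.ofReal_mul (by positivity), ENNReal.ofReal_toReal measure_ball_lt_top.ne]

/-- The ball of radius `2R` has measure `8VR³`, whose power `1/p` gives the rate: `R^{3/2}` for `p =
2` and `R^{1/2}` for `p = 6`. -/
theorem exists_eLpNorm_le_of_support_subset {F : Type*} [NormedAddCommGroup F] (p : ℝ≥0∞) :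
    ∃ c : ℝ, 0 ≤ c ∧ ∀ (R : ℝ) (_ : 0 < R) (C : ℝ) (_ : 0 ≤ C)
    (f : Space → F), (∀ x, ‖f x‖ ≤ C) →
      Function.support f ⊆ Metric.closedBall 0 (2 * R) →
      eLpNorm f p volume ≤ ENNReal.ofReal (c * C * R ^ (3 / p.toReal)) := by
  set V : ℝ := (volume (Metric.ball (0 : Space) 1)).toReal
  have hV : 0 ≤ V := ENNReal.toReal_nonneg
  refine ⟨(8 * V) ^ p.toReal⁻¹, by positivity, fun R hR C hC f hf hs => ?_⟩
  rw [← eLpNorm_restrict_eq_of_support_subset hs]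
  refine (eLpNorm_le_of_ae_bound (Eventually.of_forall hf)).trans (le_of_eq ?_)
  have hp0 : 0 ≤ p.toReal⁻¹ := by positivity
  rw [Measure.restrict_apply_univ, volume_closedBall_eq (by positivity),
    ENNReal.ofReal_rpow_of_nonneg (by positivity) hp0, ← ENNReal.ofReal_mul (by positivity)]
  congr 1
  have h1 : (2 * R) ^ 3 * V = 8 * V * R ^ (3 : ℝ) := by
    rw [show (3 : ℝ) = (3 : ℕ) by norm_num, Real.rpow_natCast]; ring
  rw [h1, Real.mul_rpow (by positivity) (by positivity), ← Real.rpow_mul hR.le, ← div_eq_mul_inv]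
  ring

/-- The first basis vector of `ℂ²`, an eigenvector of `σ₃`. -/
def spinUp : Spinor := EuclideanSpace.single 0 1

theorem norm_spinUp : ‖spinUp‖ = 1 := by simp [spinUp]

/-- The phase `exp(iλ x₃)`. -/
def phase (l : ℝ) (x : Space) : ℂ :=
  Complex.exp ((Complex.I * l) * (Complex.ofRealCLM ∘L EuclideanSpace.proj (2 : Fin 3)) x)

theorem norm_phase (l : ℝ) (x : Space) : ‖phase l x‖ = 1 := by
  have : phase l x = Complex.exp ((l * x 2 : ℝ) * Complex.I) := by
    rw [phase]
    congr 1
    simp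
    ring
  rw [this, Complex.norm_exp_ofReal_mul_I]

/-- The plane wave `exp(iλ x₃) e₁`, cut off at scale `R`. -/
def wave (l R : ℝ) (x : Space) : Spinor := (phase l x * (cutoff R x : ℂ)) • spinUp

theorem contDiff_wave (l R : ℝ) : ContDiff ℝ ∞ (wave l R) := by
  have h1 : ContDiff ℝ ∞ (phase l) :=
    (contDiff_const.mul (ContinuousLinearMap.contDiff _)).cexp
  have h2 : ContDiff ℝ ∞ fun x => (cutoff R x : ℂ) :=
    Complex.ofRealCLM.contDiff.comp (contDiff_cutoff R)
  exact (h1.mul h2).smul contDiff_const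

theorem support_wave_subset (l R : ℝ) : Function.support (wave l R) ⊆ tsupport (cutoff R) := by
  intro x hx
  refine subset_tsupport _ fun h => hx ?_
  simp [wave, h]

theorem hasCompactSupport_wave (l : ℝ) {R : ℝ} (hR : 0 < R) : HasCompactSupport (wave l R) :=
  (hasCompactSupport_cutoff hR).of_isClosed_subset (isClosed_tsupport _)
    (closure_minimal (support_wave_subset l R) (isClosed_tsupport _))

theorem norm_wave (l R : ℝ) (x : Space) : ‖wave l R x‖ = |cutoff R x| := by
  simp [wave, norm_smul, norm_phase, norm_spinUp]

theorem fderiv_wave_coord (l R : ℝ) (j : Fin 3) (x : Space) :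
    fderiv ℝ (wave l R) x (coord j) = (if j = 2 then Complex.I * l else 0 : ℂ) • wave l R x
      + (phase l x * (fderiv ℝ (cutoff R) x (coord j) : ℂ)) • spinUp := by
  have h1 : HasFDerivAt (phase l) _ x :=
    ((ContinuousLinearMap.hasFDerivAt
      (Complex.ofRealCLM ∘L EuclideanSpace.proj (2 : Fin 3))).const_mul (Complex.I * l)).cexp
  have h2 : HasFDerivAt (fun x => (cutoff R x : ℂ))
      (Complex.ofRealCLM ∘L fderiv ℝ (cutoff R) x) x :=
    Complex.ofRealCLM.hasFDerivAt.comp x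
      ((contDiff_cutoff R).differentiable (by simp) x).hasFDerivAt
  have h3 : HasFDerivAt (wave l R) _ x := (h1.mul h2).smul_const spinUp
  rw [h3.fderiv]
  simp only [ContinuousLinearMap.smulRight_apply, _root_.add_apply, _root_.smul_apply,
    ContinuousLinearMap.comp_apply, Complex.ofRealCLM_apply, smul_eq_mul]
  rw [wave, smul_smul, ← add_smul]
  congr 1
  have h4 : (EuclideanSpace.proj (2 : Fin 3) : Space →L[ℝ] ℝ) (coord j) =
      if j = 2 then 1 else 0 := by
    fin_cases j <;> simp
  rw [h4]
  change phase l x * _ + (cutoff R x : ℂ) * (phase l x * _) = _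
  split_ifs <;> push_cast <;> ring

theorem pauliCLM_two_spinUp : pauliCLM 2 spinUp = spinUp := by
  ext i
  fin_cases i <;> simp [pauliCLM, spinUp, pauli, Matrix.mulVec, dotProduct]

/-- The cut-off plane wave as a Schwartz function. -/
def waveSchwartz (l : ℝ) {R : ℝ} (hR : 0 < R) : 𝓢(Space, Spinor) :=
  (hasCompactSupport_wave l hR).toSchwartzMap (contDiff_wave l R)

theorem waveSchwartz_apply (l : ℝ) {R : ℝ} (hR : 0 < R) (x : Space) :
    waveSchwartz l hR x = wave l R x := rfl

theorem matrixAct_two_waveSchwartz (l : ℝ) {R : ℝ} (hR : 0 < R) :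
    matrixAct (pauli 2) ((waveSchwartz l hR).toLp 2) = (waveSchwartz l hR).toLp 2 := by
  apply Lp.ext
  filter_upwards [matrixAct_coeFn (pauli 2) ((waveSchwartz l hR).toLp 2),
    (waveSchwartz l hR).coeFn_toLp 2 volume] with x h1 h2
  rw [h1, h2, waveSchwartz_apply, wave, map_smul]
  congr 1
  exact pauliCLM_two_spinUp

/-- As `σ₃e₁ = e₁`, the term `λu` equals `σ₃ (1/i)(iλ)u` and can be absorbed into the third
derivative. This cancels the derivative of the phase and leaves only that of the cutoff. -/
theorem freeMap_sub_waveSchwartz (l : ℝ) {R : ℝ} (hR : 0 < R) :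
    freeMap (schwartzH1 (waveSchwartz l hR)) - (l : ℂ) • (waveSchwartz l hR).toLp 2 volume
      = ∑ j : Fin 3, matrixAct (pauli j) ((1 / Complex.I : ℂ) •
        ((∂_{coord j} (waveSchwartz l hR) : 𝓢(Space, Spinor)) -
          (if j = 2 then Complex.I * l else 0 : ℂ) • waveSchwartz l hR).toLp 2 volume) := by
  have hsub (j : Fin 3) : ((∂_{coord j} (waveSchwartz l hR) : 𝓢(Space, Spinor)) -
      (if j = 2 then Complex.I * l else 0 : ℂ) • waveSchwartz l hR).toLp 2 volume
      = (∂_{coord j} (waveSchwartz l hR) : 𝓢(Space, Spinor)).toLp 2 volume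
        - (if j = 2 then Complex.I * l else 0 : ℂ) • (waveSchwartz l hR).toLp 2 volume := by
    simp only [← SchwartzMap.toLpCLM_apply (𝕜 := ℂ), map_sub, map_smul]
  rw [freeMap_apply]
  simp only [hsub, weakPartial_schwartzH1, smul_sub, map_sub, Finset.sum_sub_distrib]
  congr 1
  rw [Fin.sum_univ_three]
  simp only [show (0 : Fin 3) ≠ 2 by decide, show (1 : Fin 3) ≠ 2 by decide, if_false, if_true,
    zero_smul, smul_zero, map_zero, zero_add, map_smul, matrixAct_two_waveSchwartz, smul_smul]
  congr 1
  field_simp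

/-- Approximate eigenfunctions of `T₀` that spread out. -/
theorem exists_approximate_eigenfunctions (l : ℝ) : ∃ a M N : ℝ, 0 < a ∧ 0 ≤ M ∧ 0 ≤ N ∧
    ∀ R : ℝ, 0 < R → ∃ u : H1, a * R ^ (3 / 2 : ℝ) ≤ ‖(u : L2Spinor)‖ ∧
      ‖freeMap u - (l : ℂ) • (u : L2Spinor)‖ ≤ M * R ^ (1 / 2 : ℝ) ∧
      eLpNorm (u : L2Spinor) 6 volume ≤ ENNReal.ofReal (N * R ^ (1 / 2 : ℝ)) := by
  obtain ⟨c₂, hc₂, h₂⟩ := exists_eLpNorm_le_of_support_subset (F := Spinor) 2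
  obtain ⟨c₆, hc₆, h₆⟩ := exists_eLpNorm_le_of_support_subset (F := Spinor) 6
  obtain ⟨K, hK₀, hK⟩ := exists_norm_fderiv_cutoff_le
  set V : ℝ := (volume (Metric.ball (0 : Space) 1)).toReal with hVdef
  have hV : 0 < V := ENNReal.toReal_pos (Metric.measure_ball_pos _ _ one_pos).ne'
    measure_ball_lt_top.ne
  refine ⟨V ^ (1 / 2 : ℝ), (∑ j, ‖matrixAct (pauli j)‖) * (c₂ * K), c₆, by positivity,
    by positivity, hc₆, fun R hR => ⟨schwartzH1 (waveSchwartz l hR), ?_, ?_, ?_⟩⟩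
  -- The wave has modulus one on the ball of radius `R`, whose volume is `VR³`.
  · change _ ≤ ‖(waveSchwartz l hR).toLp 2 volume‖
    rw [SchwartzMap.norm_toLp]
    rw [← ENNReal.ofReal_le_iff_le_toReal ((waveSchwartz l hR).memLp 2 volume).eLpNorm_ne_top]
    calc ENNReal.ofReal (V ^ (1 / 2 : ℝ) * R ^ (3 / 2 : ℝ))
        = eLpNorm ((Metric.closedBall (0 : Space) R).indicator fun _ => (1 : ℝ)) 2 volume := by
          rw [eLpNorm_indicator_const Metric.isClosed_closedBall.measurableSet (by simp) (by simp),
            volume_closedBall_eq hR, ENNReal.ofReal_rpow_of_nonneg (by positivity) (by positivity)]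
          simp only [enorm_one, one_mul, ENNReal.toReal_ofNat]
          congr 1
          rw [← hVdef, Real.mul_rpow (by positivity) hV.le, ← Real.rpow_natCast,
            ← Real.rpow_mul hR.le, mul_comm, show ((3 : ℕ) : ℝ) * (1 / 2) = 3 / 2 by norm_num]
      _ ≤ _ := by
          refine eLpNorm_mono fun x => ?_
          rw [waveSchwartz_apply, norm_wave]
          by_cases hx : x ∈ Metric.closedBall (0 : Space) R
          · rw [Set.indicator_of_mem hx, cutoff_eq_one hR (mem_closedBall_zero_iff.mp hx)]
            simp
          · rw [Set.indicator_of_notMem hx, norm_zero]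
            positivity
  · change ‖freeMap (schwartzH1 (waveSchwartz l hR)) - (l : ℂ) • (waveSchwartz l hR).toLp 2 volume‖ ≤ _
    rw [freeMap_sub_waveSchwartz, Finset.sum_mul, Finset.sum_mul]
    refine norm_sum_le_of_le _ fun j _ => ?_
    refine (ContinuousLinearMap.le_opNorm _ _).trans ?_
    rw [mul_assoc]
    refine mul_le_mul_of_nonneg_left ?_ (norm_nonneg _)
    -- What remains has size at most `K/R` on a ball of radius `2R`, hence `L²` norm of order `R⁻¹ ·
    -- R^{3/2}`.
    have hd (x : Space) : ((∂_{coord j} (waveSchwartz l hR) : 𝓢(Space, Spinor)) -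
        (if j = 2 then Complex.I * l else 0 : ℂ) • waveSchwartz l hR) x
        = (phase l x * (fderiv ℝ (cutoff R) x (coord j) : ℂ)) • spinUp := by
      have := fderiv_wave_coord l R j x
      rw [_root_.sub_apply, _root_.smul_apply, SchwartzMap.lineDerivOp_apply_eq_fderiv]
      exact sub_eq_iff_eq_add'.mpr this
    rw [norm_smul, norm_div, norm_one, Complex.norm_I, div_one, one_mul, SchwartzMap.norm_toLp]
    refine ENNReal.toReal_le_of_le_ofReal (by positivity) ?_
    refine (h₂ R hR (K / R) (by positivity) _ (fun x => ?_) fun x hx => ?_).trans (le_of_eq ?_)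
    · rw [hd, norm_smul, norm_mul, norm_phase, one_mul, norm_spinUp, mul_one, Complex.norm_real]
      refine (ContinuousLinearMap.le_opNorm _ _).trans ?_
      rw [PiLp.norm_single, norm_one, mul_one]
      exact hK R hR x
    · rw [Function.mem_support, hd] at hx
      refine tsupport_cutoff_subset hR (support_fderiv_subset ℝ (f := cutoff R) fun h => hx ?_)
      simp [h]
    · congr 1
      have h3 : R ^ (3 / 2 : ℝ) = R * R ^ (1 / 2 : ℝ) := by
        nth_rewrite 2 [← Real.rpow_one R]
        rw [← Real.rpow_add hR]
        norm_num
      rw [ENNReal.toReal_ofNat, h3]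
      field_simp
  · change eLpNorm ((waveSchwartz l hR).toLp 2 volume) 6 volume ≤ _
    rw [eLpNorm_congr_ae ((waveSchwartz l hR).coeFn_toLp 2 volume)]
    refine (h₆ R hR 1 zero_le_one _ (fun x => ?_) ?_).trans (le_of_eq ?_)
    · rw [waveSchwartz_apply, norm_wave]
      exact abs_cutoff_le R x
    · exact (support_wave_subset l R).trans (tsupport_cutoff_subset hR)
    · rw [mul_one, ENNReal.toReal_ofNat]
      norm_num

/-- The `L³`–`L⁶` Hölder bound makes the potential term no larger than the error for `T₀`. A bounded
inverse would thus force `a R^{3/2} ≤ B R^{1/2}`, that is `aR ≤ B`, for every `R > 0`. -/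
theorem real_subset_spectrumOf_weylDirac {A : Fin 3 → Space → ℝ}
    (hA : ∀ j, MemLp (A j) 3 volume) :
    Set.range ((↑) : ℝ → ℂ) ⊆ spectrumOf (weylDirac A) := by
  rintro _ ⟨l, rfl⟩ hl
  obtain ⟨K, hK⟩ := exists_norm_le_of_mem_resolventSet hl
  obtain ⟨a, M, N, ha, hM, hN, hu⟩ := exists_approximate_eigenfunctions l
  obtain ⟨C, hC⟩ := exists_eLpNorm_potentialFun_le hA
  set B : ℝ := |K| * (M + C * N) with hB
  have hB₀ : 0 ≤ B := by positivity
  -- This makes `aR = B + 1`, contradicting `aR ≤ B`.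
  set R : ℝ := (B + 1) / a with hR
  have hR₀ : 0 < R := by positivity
  obtain ⟨u, hu₁, hu₂, hu₆⟩ := hu R hR₀
  have hV : ‖potentialOp A ⟨u, H1_le_potentialOp_domain hA u.2⟩‖ ≤ C * (N * R ^ (1 / 2 : ℝ)) := by
    rw [norm_potentialOp]
    refine ENNReal.toReal_le_of_le_ofReal (by positivity) ((hC u).trans ?_)
    rw [ENNReal.ofReal_mul C.coe_nonneg, ENNReal.ofReal_coe_nnreal]
    exact mul_le_mul' le_rfl hu₆
  have hT : ‖weylDirac A ⟨u, u.2, H1_le_potentialOp_domain hA u.2⟩ - (l : ℂ) • (u : L2Spinor)‖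
      ≤ (M + C * N) * R ^ (1 / 2 : ℝ) := by
    have h : weylDirac A ⟨u, u.2, H1_le_potentialOp_domain hA u.2⟩
        = freeMap u - potentialOp A ⟨u, H1_le_potentialOp_domain hA u.2⟩ := rfl
    rw [h, sub_right_comm]
    refine (norm_sub_le _ _).trans ((add_le_add hu₂ hV).trans (le_of_eq ?_))
    ring
  have h1 : a * R ^ (3 / 2 : ℝ) ≤ B * R ^ (1 / 2 : ℝ) := by
    refine hu₁.trans ((hK ⟨u, u.2, H1_le_potentialOp_domain hA u.2⟩).trans ?_)
    refine (mul_le_mul_of_nonneg_right (le_abs_self K) (norm_nonneg _)).trans ?_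
    rw [hB, mul_assoc]
    exact mul_le_mul_of_nonneg_left hT (abs_nonneg K)
  have h3 : R ^ (3 / 2 : ℝ) = R * R ^ (1 / 2 : ℝ) := by
    nth_rewrite 2 [← Real.rpow_one R]
    rw [← Real.rpow_add hR₀]
    norm_num
  rw [h3, ← mul_assoc, hR, mul_div_cancel₀ _ ha.ne'] at h1
  have h4 := le_of_mul_le_mul_right h1 (Real.rpow_pos_of_pos hR₀ _)
  linarith

end Spectrum

end WeylDirac

end

theorem mainTheorem10 (A : Fin 3 → WeylDirac.Space → ℝ)
    (hA : ∀ j : Fin 3, MeasureTheory.MemLp (A j) 3 MeasureTheory.volume) :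
    (WeylDirac.weylDirac A).domain = WeylDirac.H1 ∧
      IsSelfAdjoint (WeylDirac.weylDirac A) ∧
      WeylDirac.spectrumOf (WeylDirac.weylDirac A) = Set.range ((↑) : ℝ → ℂ) :=
  ⟨WeylDirac.weylDirac_domain hA, WeylDirac.weylDirac_isSelfAdjoint hA,
    Set.Subset.antisymm (WeylDirac.spectrumOf_subset_real (WeylDirac.weylDirac_isSelfAdjoint hA))
      (WeylDirac.real_subset_spectrumOf_weylDirac hA)⟩
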